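/- Let $N\ge 1$ and $T\ge S\ge 0$ be integers. Consider all collections of $N$ pairwise non-intersecting lattice paths on $\mathbb Z^2$ with coordinates $(t,x)$, the $i$-th path ($i=1,\dots,N$) going from $(0,i-1)$ to $(T,S+i-1)$ by links $(t,x)\to(t+1,x)$ or $(t,x)\to(t+1,x+1)$. Choose such a collection uniformly at random, and let $H_t$ ($t=0,1,\dots,T$) be the random $N$-point set of the $x$-coordinates of its paths at time $t$; $H_t\subset\{0,\dots,L\}$ with $L=S+N-1$. Let $\mathfrak X_t=\{x\in\mathbb Z:\max(0,t+S-T)\le x\le\min(t,S)+N-1\}$, and let $$w_t(x)=\frac{1}{x!\,(t+N-1-x)!\,(S+N-1-x)!\,(T-t-S+x)!}\quad(x\in\mathfrak X_t),\qquad w_t(x)=0\quad(x\notin\mathfrak X_t).$$ Let $$H^t_k(x)=Q_k(x',\alpha,\beta,M)=\sum_{i=0}^k\frac{(-k)_i(-x')_i(k+\alpha+\beta+1)_i}{(-M)_i(\alpha+1)_i\,i!},\qquad 0\le k\le M,$$ be the Hahn polynomials, where $(a)_i=a(a+1)\cdots(a+i-1)$ and the parameters at time $t$ are (I) if $t\le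 S$, $t\le T-S$: $M=t+N-1$, $\alpha=-S-N$, $\beta=S-T-N$, $x'=x$; (II) if $S\le t\le T-S$: $M=S+N-1$, $\alpha=-t-N$, $\beta=t-N-T$, $x'=x$; (III) if $T-S\le t\le S$: $M=T-S+N-1$, $\alpha=-T+t-N$, $\beta=-t-N$, $x'=T-t-S+x$; (IV) if $t\ge S$, $t\ge T-S$: $M=T-t+N-1$, $\alpha=-T-N+S$, $\beta=-S-N$, $x'=T-t-S+x$ (the cases agree where they overlap). Put $$f^t_n(x)=\frac{H^t_n(x)\sqrt{w_t(x)}}{\sqrt{(H^t_n,H^t_n)}}\quad(0\le n\le M),\qquad (H^t_n,H^t_n)=\sum_{x\in\mathfrak X_t}H^t_n(x)^2w_t(x),$$ $f^t_n=0$ for $n>M$ (where $M=M(t)$), and $$c^t_i=\sqrt{\Bigl(1-\frac{i}{t+N}\Bigr)\Bigl(1-\frac{i}{T+N-t-1}\Bigr)}.$$ (Only those $c^t_i$ enter below for which both $f^t_i$ and $f^{t+1}_i$ are nonzero.) Then $H_t$ meets the assumptions of the extended Eynard–Mehta proposition with these $f_n^t$ and $c_n^t$, that is: 1. For each $t=0,\dots,T$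 one has $\mathfrak X_t\subset\{0,\dots,L\}$ and $|\mathfrak X_t|=M+1\ge N$, and the functions $f^t_0,\dots,f^t_M$ form an orthonormal basis of $\ell_2(\mathfrak X_t)$; moreover $c^t_n\ne0$ for $0\le n<N$ and $0\le t<T$. 2. $(H_t)_{t=0}^T$ is a Markov process with values in the $N$-point subsets of $\{0,\dots,L\}$. 3. For $x_1<\dots<x_N$ in $\{0,\dots,L\}$, $\ \mathrm{Prob}\{H_t=\{x_1,\dots,x_N\}\}=\bigl(\det_{i,j=1,\dots,N}[f^t_{i-1}(x_j)]\bigr)^2$. 4. For $0\le t<T$, $x_1<\dots<x_N$ and $y_1<\dots<y_N$ in $\{0,\dots,L\}$ with $\mathrm{Prob}\{H_t=\{x_1,\dots,x_N\}\}>0$, $$\mathrm{Prob}\{H_{t+1}=\{y_1,\dots,y_N\}\mid H_t=\{x_1,\dots,x_N\}\}=\frac{\det[v_{t,t+1}(x_i,y_j)]\,\det[f^{t+1}_{i-1}(y_j)]}{\det[f^t_{i-1}(x_j)]\,\prod_{n=0}^{N-1}c^t_n},\qquad v_{t,t+1}(x,y)=\sum_{n\ge0}c^t_nf^t_n(x)f^{t+1}_n(y).$$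 Consequently $H_t$ is determinantal: for every $n$ and all pairwise distinct pairs $(x_1,t_1),\dots,(x_n,t_n)\in\mathbb Z\times\{0,\dots,T\}$, $$\mathrm{Prob}\{x_1\in H_{t_1},\dots,x_n\in H_{t_n}\}=\det_{i,j=1,\dots,n}\bigl[K(x_i,t_i;x_j,t_j)\bigr],$$ with the extended Hahn kernel $$K(x,k;y,l)=\sum_{i=0}^{N-1}\Bigl(\prod_{j=l}^{k-1}\frac1{c^j_i}\Bigr)f^k_i(x)f^l_i(y)\quad(k\ge l),\qquad K(x,k;y,l)=-\sum_{i\ge N}\Bigl(\prod_{j=k}^{l-1}c^j_i\Bigr)f^k_i(x)f^l_i(y)\quad(k<l).$$ -/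

import Mathlib

open MeasureTheory

noncomputable section

namespace HahnPaths

/-! ### The path model -/

/-- A collection of `N` non-intersecting lattice paths. The `i`-th path (`i = 0, …, N - 1`) is at
height `pos i t` at time `t = 0, …, T`; it goes from `(0, i)` to `(T, S + i)`, each link raises the
height by `0` or `1`, and the paths are pairwise disjoint. (With such links two paths intersect
exactly when they share a lattice node.) -/
structure PathFamily (N T S : ℕ) where
  pos : Fin N → Fin (T + 1) → ℤ
  start : ∀ i, pos i 0 = ((i : ℕ) : ℤ)
  finish : ∀ i, pos i (Fin.last T) = (S : ℤ) + ((i : ℕ) : ℤ)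
  step : ∀ (i : Fin N) (t : Fin T),
    pos i t.succ = pos i t.castSucc ∨ pos i t.succ = pos i t.castSucc + 1
  disjoint : ∀ t, Function.Injective fun i => pos i t

instance (N T S : ℕ) : MeasurableSpace (PathFamily N T S) := ⊤

/-- The measure under which all path families are equiprobable. -/
def pathMeasure (N T S : ℕ) : Measure (PathFamily N T S) :=
  ProbabilityTheory.uniformOn Set.univ

/-- The process `H_t`: the set of heights occupied at time `t`. -/
def pathProcess (N T S : ℕ) (t : Fin (T + 1)) (ω : PathFamily N T S) : Finset ℤ :=
  Finset.univ.image fun i => ω.pos i t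

/-! ### Processes of point configurations -/

section Processes

variable {Ω : Type*} [MeasurableSpace Ω]

/-- The Markov property of a process with discrete time `0, …, T` and discrete states. -/
def IsMarkovProcess {E : Type*} {T : ℕ} (P : Measure Ω) (X : Fin (T + 1) → Ω → E) : Prop :=
  ∀ (t : Fin T) (a : Fin (T + 1) → E),
    P {ω | ∀ s ≤ t.castSucc, X s ω = a s} ≠ 0 →
      (ProbabilityTheory.cond P {ω | ∀ s ≤ t.castSucc, X s ω = a s}).real
          {ω | X t.succ ω = a t.succ} =
        (ProbabilityTheory.cond P {ω | X t.castSucc ω = a t.castSucc}).real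
          {ω | X t.succ ω = a t.succ}

/-- The process `X` is determinantal with dynamical correlation kernel `K (x, s; y, t)`. -/
def IsDeterminantalWithKernel {T : ℕ} (P : Measure Ω) (X : Fin (T + 1) → Ω → Finset ℤ)
    (K : ℤ → ℕ → ℤ → ℕ → ℝ) : Prop :=
  ∀ (n : ℕ) (x : Fin n → ℤ) (t : Fin n → Fin (T + 1)),
    (Function.Injective fun i => (x i, t i)) →
      P.real {ω | ∀ i, x i ∈ X (t i) ω} =
        (Matrix.of fun i j : Fin n => K (x i) (t i) (x j) (t j)).det

/-- `v_{t,t+1}(x, y) = ∑_{n ≥ 0} c_n^t f_n^t(x) f_n^{t+1}(y)`, where `f t n` is the zero function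
when the system at time `t` has no `n`-th member; on `{0, …, L}` a system has at most `L + 1`
members. -/
def linkSum (L : ℕ) (f : ℕ → ℕ → ℤ → ℝ) (c : ℕ → ℕ → ℝ) (t : ℕ) (x y : ℤ) : ℝ :=
  ∑ n ∈ Finset.range (L + 1), c t n * f t n x * f (t + 1) n y

/-- The hypotheses of the extended Eynard–Mehta proposition on a process `X` with times `0, …, T`,
for the orthonormal bases `f t 0, f t 1, …` of `ℓ²(A t)`, `A t ⊆ {0, …, L}` (extended by zero
outside `A t`), and the numbers `c t n`. -/
structure MeetsEynardMehta {T : ℕ} (P : Measure Ω) (X : Fin (T + 1) → Ω → Finset ℤ) (L N : ℕ)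
    (A : ℕ → Finset ℤ) (f : ℕ → ℕ → ℤ → ℝ) (c : ℕ → ℕ → ℝ) : Prop where
  /-- The underlying measure is a probability measure. -/
  isProbabilityMeasure : IsProbabilityMeasure P
  /-- `X` is a random variable at each time. -/
  measurable : ∀ t B, MeasurableSet {ω | X t ω = B}
  /-- `X` takes values in the `N`-point subsets of `{0, …, L}`. -/
  state_subset : ∀ t ω, X t ω ⊆ Finset.Icc 0 (L : ℤ)
  state_card : ∀ t ω, (X t ω).card = N
  /-- `A t` is a subset of `{0, …, L}` with at least `N` points. -/
  carrier_subset : ∀ t ≤ T, A t ⊆ Finset.Icc 0 (L : ℤ)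
  carrier_card : ∀ t ≤ T, N ≤ (A t).card
  /-- `f t n` lives on `A t`. -/
  support : ∀ t ≤ T, ∀ n, ∀ x ∉ A t, f t n x = 0
  /-- The first `(A t).card` functions are orthonormal, hence an orthonormal basis of `ℓ²(A t)`. -/
  orthonormal : ∀ t ≤ T, ∀ m < (A t).card, ∀ n < (A t).card,
    ∑ x ∈ A t, f t m x * f t n x = if m = n then 1 else 0
  /-- There are no further functions in the system. -/
  exhausted : ∀ t ≤ T, ∀ n, (A t).card ≤ n → ∀ x, f t n x = 0
  /-- The coefficients that are divided by do not vanish. -/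
  coeff_ne_zero : ∀ t < T, ∀ n < N, c t n ≠ 0
  /-- `X` is a Markov process. -/
  markov : IsMarkovProcess P X
  /-- The one-dimensional distributions. -/
  distribution : ∀ (t : Fin (T + 1)) (x : Fin N → ℤ), StrictMono x →
    (∀ i, x i ∈ Finset.Icc 0 (L : ℤ)) →
    P.real {ω | X t ω = Finset.univ.image x} =
      (Matrix.of fun i j : Fin N => f t i (x j)).det ^ 2
  /-- The one-step transition probabilities. -/
  transition : ∀ (t : Fin T) (x y : Fin N → ℤ), StrictMono x → StrictMono y →
    (∀ i, x i ∈ Finset.Icc 0 (L : ℤ)) → (∀ i, y i ∈ Finset.Icc 0 (L : ℤ)) →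
    P {ω | X t.castSucc ω = Finset.univ.image x} ≠ 0 →
    (ProbabilityTheory.cond P {ω | X t.castSucc ω = Finset.univ.image x}).real
        {ω | X t.succ ω = Finset.univ.image y} =
      (Matrix.of fun i j : Fin N => linkSum L f c t (x i) (y j)).det *
          (Matrix.of fun i j : Fin N => f ((t : ℕ) + 1) i (y j)).det /
        ((Matrix.of fun i j : Fin N => f t i (x j)).det * ∏ n ∈ Finset.range N, c t n)

end Processes

/-- The extended kernel `K(x, k; y, l)` built from functions `f` and coefficients `c`:
`∑_{i < N} f_i^k(x) f_i^l(y) / (c_i^l ⋯ c_i^{k-1})` if `k ≥ l`, and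
`-∑_{i ≥ N} c_i^k ⋯ c_i^{l-1} f_i^k(x) f_i^l(y)` if `k < l`. -/
def extendedKernel (L N : ℕ) (f : ℕ → ℕ → ℤ → ℝ) (c : ℕ → ℕ → ℝ) (x : ℤ) (k : ℕ) (y : ℤ) (l : ℕ) :
    ℝ :=
  if l ≤ k then
    ∑ i ∈ Finset.range N, 1 / (∏ j ∈ Finset.Ico l k, c j i) * f k i x * f l i y
  else
    -∑ i ∈ Finset.Ico N (L + 1), (∏ j ∈ Finset.Ico k l, c j i) * f k i x * f l i y

/-! ### Hahn polynomials and Hahn functions -/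

/-- The Pochhammer symbol `(a)_i = a (a + 1) ⋯ (a + i - 1)`. -/
def poch (a : ℝ) (i : ℕ) : ℝ := (ascPochhammer ℝ i).eval a

/-- The Hahn polynomial `Q_k(x, α, β, M) = ₃F₂(-k, -x, k + α + β + 1; -M, α + 1; 1)`. -/
def hahnQ (k : ℕ) (x α β M : ℝ) : ℝ :=
  ∑ i ∈ Finset.range (k + 1),
    poch (-k) i * poch (-x) i * poch (k + α + β + 1) i /
      (poch (-M) i * poch (α + 1) i * (Nat.factorial i : ℝ))

/-- The parameter `α` at time `t`. The four cases are
(I) `t ≤ S`, `t ≤ T - S`; (II) `S ≤ t ≤ T - S`; (III) `T - S ≤ t ≤ S`; (IV) `t ≥ S`, `t ≥ T - S`;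
where they overlap they agree. -/
def hahnAlpha (N T S t : ℕ) : ℤ :=
  if t + S ≤ T then (if t ≤ S then -S - N else -t - N)
  else (if t ≤ S then -T + t - N else -T - N + S)

/-- The parameter `β` at time `t`. -/
def hahnBeta (N T S t : ℕ) : ℤ :=
  if t + S ≤ T then (if t ≤ S then S - T - N else t - N - T)
  else (if t ≤ S then -t - N else -S - N)

/-- The parameter `M` at time `t`. -/
def hahnM (N T S t : ℕ) : ℤ :=
  if t + S ≤ T then (if t ≤ S then t + N - 1 else S + N - 1)
  else (if t ≤ S then T - S + N - 1 else T - t + N - 1)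

/-- The shifted coordinate `x'` at time `t`. -/
def hahnShift (T S t : ℕ) (x : ℤ) : ℤ :=
  if t + S ≤ T then x else T - t - S + x

/-- The support of the weight at time `t`. -/
def hahnSupport (N T S t : ℕ) : Finset ℤ :=
  Finset.Icc (max 0 ((t : ℤ) + S - T)) (min ((t : ℤ) + N - 1) ((S : ℤ) + N - 1))

/-- The weight `w_t(x) = 1 / (x! (t + N - 1 - x)! (S + N - 1 - x)! (T - t - S + x)!)` on its
support, and `0` elsewhere. -/
def hahnWeight (N T S t : ℕ) (x : ℤ) : ℝ :=
  if x ∈ hahnSupport N T S t then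
    1 / ((Nat.factorial x.toNat : ℝ) * (Nat.factorial ((t : ℤ) + N - 1 - x).toNat : ℝ) *
      (Nat.factorial ((S : ℤ) + N - 1 - x).toNat : ℝ) *
      (Nat.factorial ((T : ℤ) - t - S + x).toNat : ℝ))
  else 0

/-- The shifted Hahn polynomial `H_k^t(x)`. -/
def hahnH (N T S t k : ℕ) (x : ℤ) : ℝ :=
  hahnQ k (hahnShift T S t x) (hahnAlpha N T S t) (hahnBeta N T S t) (hahnM N T S t)

/-- The squared norm `(H_k^t, H_k^t)` with respect to the weight `w_t`. -/
def hahnNormSq (N T S t k : ℕ) : ℝ :=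
  ∑ x ∈ hahnSupport N T S t, hahnH N T S t k x ^ 2 * hahnWeight N T S t x

/-- `f_n^t(x) = H_n^t(x) √w_t(x) / √(H_n^t, H_n^t)` for `n = 0, …, M`; the zero function for the
values `n > M`, for which there is no Hahn polynomial. -/
def hahnF (N T S t n : ℕ) (x : ℤ) : ℝ :=
  if (n : ℤ) ≤ hahnM N T S t then
    hahnH N T S t n x * Real.sqrt (hahnWeight N T S t x) / Real.sqrt (hahnNormSq N T S t n)
  else 0

/-- `c_i^t = √((1 - i / (t + N)) (1 - i / (T + N - t - 1)))`. -/
def hahnC (N T t i : ℕ) : ℝ :=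
  Real.sqrt ((1 - (i : ℝ) / ((t : ℝ) + N)) * (1 - (i : ℝ) / ((T : ℝ) + N - t - 1)))

end HahnPaths

end

/-! The analytic core is one difference operator. Let `U` send a function `ψ` at time `t+1` to
`(T-t-S+x)ψ(x) + (S+N-1-x)ψ(x+1)` at time `t`. Its adjoint for the weights `w_t`, `w_{t+1}` is `φ ↦
(t+N-y)φ(y) + yφ(y-1)` (`sum_hahnWeight_step_adjoint`). Neither operator raises degrees: they
multiply the coefficient of degree `n` by `T+N-t-1-n` and `t+N-n`. Orthogonality then makes `U`
diagonal in the Hahn bases. The product of the two expressions for a diagonal entry is its square,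
so no closed form of the norms is needed, and the sign `(-1)^n` of the leading coefficients selects
the positive root (`sum_hahnH_step_hahnH`). Up to a gauge factor `U` is the indicator of the steps
`x → x, x+1`, so `v_{t,t+1}` is that gauged indicator (`linkSum_hahnF_eq_stepKernel`).

A determinant of unit steps between increasing sequences reduces to its diagonal product, and along
a path family the gauge factors telescope. Hence the product `det f^0 · ∏ det v_{t,t+1} / ∏ c · det
f^T` vanishes unless the trajectory is a path family and takes one and the same value on all of
them. By Cauchy–Binet, `det f^t` is preserved by the normalized link determinants on both sides, so
the total mass is one and the product is the uniform law (`hasChainLaw_pathMeasure`). The same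
invariance sums out past and future, which gives the marginals, the Markov property and the
transition probabilities.

For the correlations, the generating function of products `1 + s·1[x_i occupied at t_i]` is, again
by Cauchy–Binet, an `N × N` determinant of one-particle operators. Sylvester's identity turns it
into `det (1 + sK)` with `K` the extended kernel (`det_one_add_smul_extended`), and the top
coefficient in `s` is the correlation function. The semigroup property of the links used here needs
that an index present at two times is also present in between (`card_between`). -/

noncomputable section

namespace HahnPaths

/-! ### Determinants -/

section Determinants

variable {R : Type*} [CommRing R]

/-- The **Cauchy–Binet formula**. -/
theorem det_mul_eq_sum_orderEmbedding {N : ℕ} {E : Type*} [Fintype E] [LinearOrder E]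
    (A : Matrix (Fin N) E R) (B : Matrix E (Fin N) R) :
    (A * B).det =
      ∑ y : Fin N ↪o E, (A.submatrix id y).det * (B.submatrix y id).det := by
  classical
  -- Multilinearity in the rows expands the determinant over all maps `Fin N → E`.
  have h1 : (A * B).det = ∑ f : Fin N → E, (∏ i, A i (f i)) * (B.submatrix f id).det := by
    have : A * B = Matrix.of fun i => ∑ e, A i e • B e := by
      ext i j
      simp [Matrix.mul_apply, Finset.sum_apply]
    rw [this]
    change Matrix.detRowAlternating.toMultilinearMap (fun i => ∑ e, A i e • B e) = _
    rw [MultilinearMap.map_sum]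
    refine Finset.sum_congr rfl fun f _ => ?_
    rw [MultilinearMap.map_smul_univ]
    rfl
  have h2 : ∀ y : Fin N ↪o E, (A.submatrix id y).det * (B.submatrix y id).det =
      ∑ σ : Equiv.Perm (Fin N),
        (∏ i, A i (y (σ i))) * (B.submatrix (fun i => y (σ i)) id).det := by
    intro y
    rw [← Matrix.det_transpose, Matrix.det_apply', Finset.sum_mul]
    refine Finset.sum_congr rfl fun σ _ => ?_
    have : B.submatrix (fun i => y (σ i)) id = (B.submatrix y id).submatrix σ id := rfl
    rw [this, Matrix.det_permute]
    simp only [Matrix.transpose_apply, Matrix.submatrix_apply, id]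
    ring
  rw [h1, Finset.sum_congr rfl fun y _ => h2 y, ← Finset.sum_product', eq_comm]
  -- An injective map is uniquely an increasing embedding composed with a permutation, found by
  -- sorting; a non-injective map gives two equal rows and contributes nothing.
  refine Finset.sum_of_injOn (fun p : (Fin N ↪o E) × Equiv.Perm (Fin N) => fun i => p.1 (p.2 i))
    ?_ (by simp) ?_ (by simp)
  · rintro ⟨y, σ⟩ - ⟨y', σ'⟩ - h
    simp only at h
    have hr : Set.range y = Set.range y' := by
      have e1 : Set.range y = Set.range fun i => y (σ i) := (σ.surjective.range_comp y).symm
      have e2 : Set.range y' = Set.range fun i => y' (σ' i) := (σ'.surjective.range_comp y').symm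
      rw [e1, e2, h]
    have hy : y = y' := OrderEmbedding.range_inj.mp hr
    subst hy
    refine Prod.ext rfl (Equiv.ext fun i => y.injective (congrFun h i))
  · intro f _ hf
    by_cases hinj : Function.Injective f
    · exfalso
      apply hf
      have hm : StrictMono (f ∘ Tuple.sort f) :=
        (Tuple.monotone_sort f).strictMono_of_injective (hinj.comp (Tuple.sort f).injective)
      refine ⟨(OrderEmbedding.ofStrictMono _ hm, (Tuple.sort f)⁻¹), by simp, ?_⟩
      funext i
      simp
    · obtain ⟨i, j, hij, hne⟩ : ∃ i j, f i = f j ∧ i ≠ j := by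
        simpa [Function.Injective] using hinj
      rw [Matrix.det_zero_of_row_eq hne, mul_zero]
      funext k
      simp [hij]

/-- An inversion `i < j`, `σ j < σ i` in a surviving permutation would force `y j ≥ y i + 1 ≥ x (σ
i) + 1 ≥ x (σ j) + 2`, too far for one step. So only the identity survives: the
Lindström–Gessel–Viennot argument for a single time step. -/
theorem det_eq_prod_of_unit_steps {N : ℕ} (φ : ℤ → ℤ → R)
    (hφ : ∀ x y, φ x y ≠ 0 → y = x ∨ y = x + 1) {x y : Fin N → ℤ}
    (hx : StrictMono x) (hy : StrictMono y) :
    (Matrix.of fun i j => φ (x i) (y j)).det = ∏ i, φ (x i) (y i) := by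
  classical
  rw [Matrix.det_apply', Finset.sum_eq_single 1]
  · simp
  · intro σ _ hσ
    suffices h : ∃ i, φ (x (σ i)) (y i) = 0 by
      obtain ⟨i, hi⟩ := h
      rw [Finset.prod_eq_zero (Finset.mem_univ i) (by simpa using hi), mul_zero]
    by_contra! h
    have hm : StrictMono σ := by
      intro i j hij
      by_contra hle
      have hlt : σ j < σ i := lt_of_le_of_ne (not_lt.mp hle) fun e => hij.ne' (σ.injective e)
      have := hx hlt
      have := hy hij
      have := hφ _ _ (h i)
      have := hφ _ _ (h j)
      omega
    apply hσ
    have : (hm.orderIsoOfSurjective σ σ.surjective) = OrderIso.refl _ := Subsingleton.elim _ _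
    ext i
    exact congrArg Fin.val (DFunLike.congr_fun this i)
  · simp

/-- Sylvester-type evaluation of the Fredholm determinant of an extended kernel: if `y` is
transported by `y_{t+1} = y_t (1 + u_t) v_{t,t+1}`, where `u_t` is `s` times the counting function
of the points `(τ i, ξ i)` at time `t`, then `det (1 + s (Φ̂ᵀ Ψ̂ - v̂))` is the determinant of
`y_T (1 + u_T) Φ_Tᵀ`. -/
theorem det_one_add_smul_extended {N T : ℕ} {E ι : Type*} [Fintype E] [DecidableEq E] [Fintype ι]
    [DecidableEq ι] (Ψ Φ : ℕ → Matrix (Fin N) E R) (v : ℕ → ℕ → Matrix E E R)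
    (hΨ : ∀ t < T, Ψ t * v t (t + 1) = Ψ (t + 1))
    (hv : ∀ k t, k < t → t < T → v k t * v t (t + 1) = v k (t + 1))
    (hvΦ : ∀ k < T, Φ T * (v k T).transpose = Φ k)
    (hΨΦ : Ψ T * (Φ T).transpose = 1)
    (s : R) (τ : ι → ℕ) (hτ : ∀ i, τ i ≤ T) (ξ : ι → E) (u : ℕ → E → R)
    (hu : ∀ t x, u t x = ∑ i, if τ i = t ∧ ξ i = x then s else 0)
    (y : ℕ → Matrix (Fin N) E R) (hy0 : y 0 = Ψ 0)
    (hy : ∀ t < T, y (t + 1) = y t * Matrix.diagonal (fun x => 1 + u t x) * v t (t + 1)) :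
    (1 + s • Matrix.of fun i j : ι => (∑ n, Φ (τ i) n (ξ i) * Ψ (τ j) n (ξ j)) -
        if τ i < τ j then v (τ i) (τ j) (ξ i) (ξ j) else 0).det =
      (y T * Matrix.diagonal (fun x => 1 + u T x) * (Φ T).transpose).det := by
  -- Discrete Duhamel formula: expand each factor `1 + u` and record the last time at which `u` was
  -- chosen.
  have key : ∀ l ≤ T, y l = Ψ l +
      ∑ k ∈ Finset.range l, y k * Matrix.diagonal (u k) * v k l := by
    intro l
    induction l with
    | zero => simp [hy0]
    | succ l ih =>
      intro hl
      have hd : Matrix.diagonal (fun x => 1 + u l x) = 1 + Matrix.diagonal (u l) := by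
        rw [← Matrix.diagonal_one, Matrix.diagonal_add]
      rw [hy l hl, hd, Matrix.mul_add, Matrix.mul_one, Matrix.add_mul]
      nth_rewrite 1 [ih (by omega)]
      rw [Finset.sum_range_succ, Matrix.add_mul, hΨ l hl, Matrix.sum_mul, add_assoc]
      congr 2
      refine Finset.sum_congr rfl fun k hk => ?_
      rw [Matrix.mul_assoc _ (v k l), hv k l (Finset.mem_range.mp hk) hl]
  have hvΦ' : ∀ k < T, v k T * (Φ T).transpose = (Φ k).transpose := by
    intro k hk
    rw [← hvΦ k hk, Matrix.transpose_mul, Matrix.transpose_transpose]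
  have hfin : y T * Matrix.diagonal (fun x => 1 + u T x) * (Φ T).transpose =
      1 + ∑ l ∈ Finset.range (T + 1), y l * Matrix.diagonal (u l) * (Φ l).transpose := by
    have hd : Matrix.diagonal (fun x => 1 + u T x) = 1 + Matrix.diagonal (u T) := by
      rw [← Matrix.diagonal_one, Matrix.diagonal_add]
    rw [hd, Matrix.mul_add, Matrix.mul_one, Matrix.add_mul]
    nth_rewrite 1 [key T le_rfl]
    rw [Finset.sum_range_succ, Matrix.add_mul, hΨΦ, Matrix.sum_mul, add_assoc]
    congr 2
    refine Finset.sum_congr rfl fun k hk => ?_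
    rw [Matrix.mul_assoc _ (v k T), hvΦ' k (Finset.mem_range.mp hk)]
  have hdiag : ∀ (l : ℕ) (n : Fin N) (w : E → R),
      ∑ x, (y l * Matrix.diagonal (u l)) n x * w x =
        ∑ i, if τ i = l then s * (y l n (ξ i) * w (ξ i)) else 0 := by
    intro l n w
    simp only [Matrix.mul_diagonal, hu, Finset.mul_sum, Finset.sum_mul]
    rw [Finset.sum_comm]
    refine Finset.sum_congr rfl fun i _ => ?_
    rw [Finset.sum_eq_single (ξ i)]
    · by_cases h : τ i = l
      · simp only [h, and_self, if_true]
        ring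
      · simp [h]
    · intro x _ hx
      simp [hx.symm]
    · simp
  set Y : Matrix (Fin N) ι R := Matrix.of fun n i => y (τ i) n (ξ i) with hY
  set F : Matrix (Fin N) ι R := Matrix.of fun n i => Φ (τ i) n (ξ i) with hF
  set G : Matrix (Fin N) ι R := Matrix.of fun n i => Ψ (τ i) n (ξ i) with hG
  set V : Matrix ι ι R :=
    Matrix.of fun i j => if τ i < τ j then v (τ i) (τ j) (ξ i) (ξ j) else 0 with hV
  have hYF : y T * Matrix.diagonal (fun x => 1 + u T x) * (Φ T).transpose =
      1 + s • (Y * F.transpose) := by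
    rw [hfin]
    congr 1
    ext n m
    rw [Matrix.sum_apply, Matrix.smul_apply, Matrix.mul_apply, smul_eq_mul, Finset.mul_sum]
    rw [Finset.sum_congr rfl fun l _ => (Matrix.mul_apply.trans (hdiag l n _))]
    rw [Finset.sum_comm]
    refine Finset.sum_congr rfl fun i _ => ?_
    rw [Finset.sum_eq_single (τ i)]
    · simp [hY, hF]
    · intro l _ hl
      simp [hl.symm]
    · intro h
      exact absurd (Finset.mem_range.mpr (Nat.lt_succ_of_le (hτ i))) h
  -- This is `key` read only at the marked points: a linear system for the samples of `y`.
  have hYV : Y * (1 - s • V) = G := by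
    rw [Matrix.mul_sub, Matrix.mul_one, sub_eq_iff_eq_add]
    ext n j
    simp only [hY, Matrix.of_apply]
    rw [key (τ j) (hτ j)]
    rw [Matrix.add_apply, Matrix.add_apply, Matrix.sum_apply,
      Finset.sum_congr rfl fun l _ => (Matrix.mul_apply.trans (hdiag l n _))]
    congr 1
    rw [Finset.sum_comm, Matrix.mul_apply]
    refine Finset.sum_congr rfl fun i _ => ?_
    simp only [Matrix.smul_apply, hV, Matrix.of_apply, smul_eq_mul]
    by_cases h : τ i < τ j
    · rw [Finset.sum_eq_single (τ i)]
      · simp [h]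
        ring
      · intro l _ hl
        simp [hl.symm]
      · intro h'
        exact absurd (Finset.mem_range.mpr h) h'
    · rw [if_neg h, mul_zero, mul_zero]
      refine Finset.sum_eq_zero fun l hl => ?_
      rw [if_neg]
      rintro rfl
      exact h (Finset.mem_range.mp hl)
  -- `V` strictly increases time, so `1 - s • V` is block unitriangular with respect to `τ`.
  have hdet : (1 - s • V).det = 1 := by
    have htri : (1 - s • V).BlockTriangular τ := by
      intro i j hij
      have hne : i ≠ j := by rintro rfl; exact lt_irrefl _ hij
      simp [hV, hne, hij.le]
    rw [htri.det]
    refine Finset.prod_eq_one fun k _ => ?_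
    have : (1 - s • V).toSquareBlock τ k = 1 := by
      ext ⟨i, hi⟩ ⟨j, hj⟩
      simp [Matrix.toSquareBlock_def, hV, hi, hj, Matrix.one_apply]
    rw [this, Matrix.det_one]
  -- Replacing `G` by `Y (1 - s V)` factors out `1 - s V`; Sylvester's identity then passes from
  -- marked points to the `N` indices.
  have hmat : (1 + s • Matrix.of fun i j : ι => (∑ n, Φ (τ i) n (ξ i) * Ψ (τ j) n (ξ j)) -
        if τ i < τ j then v (τ i) (τ j) (ξ i) (ξ j) else 0) =
      (1 + F.transpose * (s • Y)) * (1 - s • V) := by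
    rw [add_mul, one_mul, Matrix.mul_assoc, Matrix.smul_mul, hYV]
    ext i j
    simp [hV, hF, hG, Matrix.mul_apply, Finset.mul_sum, mul_sub]
    simp only [mul_left_comm s]
    abel
  rw [hmat, Matrix.det_mul, hdet, mul_one, Matrix.det_one_add_mul_comm, hYF, Matrix.smul_mul]

end Determinants

/-! ### Sums over chains of states -/

/-- The row vector `a m_0 m_1 ⋯ m_{t-1}`. -/
def chainVec {S : Type*} [Fintype S] (a : S → ℝ) (m : ℕ → S → S → ℝ) : ℕ → S → ℝ
  | 0 => a
  | t + 1 => fun y => ∑ x, chainVec a m t x * m t x y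

theorem sum_chain {S : Type*} [Fintype S] (a : S → ℝ) (m : ℕ → S → S → ℝ) (T : ℕ) (b : S → ℝ) :
    ∑ x : Fin (T + 1) → S,
        a (x 0) * (∏ t : Fin T, m t (x t.castSucc) (x t.succ)) * b (x (Fin.last T)) =
      ∑ y, chainVec a m T y * b y := by
  induction T generalizing b with
  | zero =>
    rw [← (Equiv.funUnique (Fin 1) S).sum_comp]
    simp [chainVec]
  | succ T ih =>
    -- The last transition is absorbed into the terminal vector.
    have h := ih fun x => ∑ y, m T x y * b y
    have e : ∑ y, chainVec a m (T + 1) y * b y =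
        ∑ x, chainVec a m T x * ∑ y, m T x y * b y := by
      simp only [chainVec, Finset.sum_mul, Finset.mul_sum]
      rw [Finset.sum_comm]
      simp only [mul_assoc]
    rw [e, ← h, ← (Fin.snocEquiv fun _ : Fin (T + 2) => S).sum_comp, Fintype.sum_prod_type_right]
    refine Finset.sum_congr rfl fun x _ => ?_
    rw [Finset.mul_sum]
    refine Finset.sum_congr rfl fun y _ => ?_
    rw [Fin.prod_univ_castSucc]
    have h0 : Fin.snoc (α := fun _ => S) x y 0 = x 0 := by
      rw [← Fin.castSucc_zero, Fin.snoc_castSucc]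
    simp only [Fin.snocEquiv_apply, h0, Fin.snoc_last, Fin.snoc_castSucc, Fin.succ_last,
      ← Fin.castSucc_succ, Fin.val_castSucc, Fin.val_last]
    ring

/-! ### Orthogonality of the Hahn polynomials -/

section Orthogonality

open Polynomial Nat

theorem poch_neg_natCast (n i : ℕ) : poch (-(n : ℝ)) i = (-1) ^ i * (n.descFactorial i : ℝ) := by
  rw [poch, ascPochhammer_eval_neg_eq_descPochhammer, descPochhammer_eval_eq_descFactorial]

theorem cast_descFactorial_eq_div {n i : ℕ} (h : i ≤ n) :
    (n.descFactorial i : ℝ) = (n ! : ℝ) / ((n - i)! : ℝ) := by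
  rw [eq_div_iff (by positivity), mul_comm]
  exact_mod_cast Nat.factorial_mul_descFactorial h

/-- The weight `1 / (x! (a - x)! (b - x)! (c + x)!)` on `0 ≤ x ≤ min a b`. -/
def factorialWeight (a b c x : ℕ) : ℝ :=
  if x ≤ a ∧ x ≤ b then
    1 / ((x ! : ℝ) * ((a - x)! : ℝ) * ((b - x)! : ℝ) * ((c + x)! : ℝ))
  else 0

/-- This is the Chu–Vandermonde identity. The terms `x < i` vanish, and with `x = i + p` the
factorials regroup into `C(a-i, p) C(b+c-j, b-i-p)` times a constant. -/
theorem sum_poch_mul_descFactorial_mul_factorialWeight {a b c i j : ℕ} (hia : i ≤ a) (hib : i ≤ b)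
    (hja : j ≤ a + c) (hjb : j ≤ b + c) :
    ∑ x ∈ Finset.range (b + 1),
        poch (-(x : ℝ)) i * ((c + x).descFactorial j : ℝ) * factorialWeight a b c x =
      (-1) ^ i * ((a + b + c - i - j)! : ℝ) /
        (((a - i)! : ℝ) * ((b - i)! : ℝ) * ((a + c - j)! : ℝ) * ((b + c - j)! : ℝ)) := by
  have hsplit : b + 1 = i + (b - i + 1) := by omega
  have hzero : ∑ x ∈ Finset.range i,
      poch (-(x : ℝ)) i * ((c + x).descFactorial j : ℝ) * factorialWeight a b c x = 0 := by
    refine Finset.sum_eq_zero fun x hx => ?_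
    rw [poch_neg_natCast, Nat.descFactorial_of_lt (Finset.mem_range.mp hx)]
    simp
  have hterm : ∀ p ∈ Finset.range (b - i + 1),
      poch (-((i + p : ℕ) : ℝ)) i * ((c + (i + p)).descFactorial j : ℝ) *
          factorialWeight a b c (i + p) =
        (-1) ^ i / (((a - i)! : ℝ) * ((b + c - j)! : ℝ)) *
          (((a - i).choose p * (b + c - j).choose (b - i - p) : ℕ) : ℝ) := by
    intro p hp
    have hp' : i + p ≤ b := by
      have := Finset.mem_range.mp hp
      omega
    by_cases hpa : i + p ≤ a
    · by_cases hj : j ≤ c + (i + p)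
      · rw [poch_neg_natCast, cast_descFactorial_eq_div hj, cast_descFactorial_eq_div (by omega),
          factorialWeight, if_pos ⟨hpa, hp'⟩, Nat.cast_mul, Nat.cast_choose ℝ (by omega),
          Nat.cast_choose ℝ (by omega)]
        have e1 : i + p - i = p := by omega
        have e2 : a - i - p = a - (i + p) := by omega
        have e3 : b - i - p = b - (i + p) := by omega
        have e4 : b + c - j - (b - (i + p)) = c + (i + p) - j := by omega
        rw [e1, e2, e3, e4]
        field_simp
      · rw [Nat.descFactorial_of_lt (by omega),
          Nat.choose_eq_zero_of_lt (show b + c - j < b - i - p by omega)]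
        simp
    · rw [factorialWeight, if_neg (by omega), Nat.choose_eq_zero_of_lt (show a - i < p by omega)]
      simp
  rw [hsplit, Finset.sum_range_add, hzero, zero_add, Finset.sum_congr rfl hterm, ← Finset.mul_sum,
    ← Nat.cast_sum, ← Finset.Nat.sum_antidiagonal_eq_sum_range_succ
      (fun p q => (a - i).choose p * (b + c - j).choose q), ← Nat.add_choose_eq,
    Nat.cast_choose ℝ (by omega)]
  have e1 : a - i + (b + c - j) = a + b + c - i - j := by omega
  have e2 : a + b + c - i - j - (b - i) = a + c - j := by omega
  rw [e1, e2]
  field_simp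

/-- Up to sign, the sum is the `k`-th forward difference at `0`, which kills polynomials of degree
below `k`. -/
theorem sum_choose_mul_eval_eq_zero {k : ℕ} {P : ℝ[X]} (hP : P.natDegree < k) :
    ∑ i ∈ Finset.range (k + 1), (-1) ^ i * (k.choose i : ℝ) * P.eval (i : ℝ) = 0 := by
  have h := congrFun (Polynomial.fwdDiff_iter_eq_zero_of_degree_lt hP) 0
  rw [fwdDiff_iter_eq_sum_shift] at h
  have h' := congrArg (fun z => (-1 : ℝ) ^ k * z) h
  simp only [Pi.zero_apply, mul_zero, Finset.mul_sum] at h'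
  rw [← h']
  refine Finset.sum_congr rfl fun i hi => ?_
  have hi' : i ≤ k := Nat.lt_succ_iff.mp (Finset.mem_range.mp hi)
  simp only [zsmul_eq_mul, zero_add, nsmul_eq_mul, mul_one]
  push_cast
  have : (-1 : ℝ) ^ k * (-1) ^ (k - i) = (-1) ^ i := by
    rw [← pow_add, show k + (k - i) = i + 2 * (k - i) by omega, pow_add, pow_mul]
    simp
  rw [← mul_assoc, ← mul_assoc, this]

/-- The Hahn polynomial `₃F₂(-k, -x, k - s - 1; -a, -b; 1)` as a polynomial in `x`. -/
def hahnPoly (k a b : ℕ) (s : ℝ) : ℝ[X] :=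
  ∑ i ∈ Finset.range (k + 1),
    C (poch (-k) i * poch (k - s - 1) i / (poch (-a) i * poch (-b) i * (i ! : ℝ))) *
      (ascPochhammer ℝ i).comp (-X)

theorem eval_hahnPoly (k a b : ℕ) (s x : ℝ) :
    (hahnPoly k a b s).eval x = ∑ i ∈ Finset.range (k + 1),
      poch (-k) i * poch (-x) i * poch (k - s - 1) i / (poch (-a) i * poch (-b) i * (i ! : ℝ)) := by
  rw [hahnPoly, eval_finsetSum]
  refine Finset.sum_congr rfl fun i _ => ?_
  simp only [eval_mul, eval_C, eval_comp, eval_neg, eval_X, poch]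
  ring

/-- The test functions `(c+x)(c+x-1)⋯` are chosen because each term of the `₃F₂` can then be summed
over `x` by Vandermonde. What remains is an alternating binomial sum over `i` of a polynomial of
degree `k-1-j`. -/
theorem sum_hahnPoly_mul_descFactorial {a b c k j : ℕ} (hka : k ≤ a) (hkb : k ≤ b) (hj : j < k) :
    ∑ x ∈ Finset.range (b + 1), factorialWeight a b c x *
      (hahnPoly k a b ((a + b + c : ℕ) : ℝ)).eval (x : ℝ) * ((c + x).descFactorial j : ℝ) = 0 := by
  set s := a + b + c with hs
  -- `P(i) = (s-i-j)! / (s+1-k-i)!`: the numerator comes from Vandermonde, the denominator from the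
  -- Pochhammer symbol `(k-s-1)_i`.
  set P : ℝ[X] := (descPochhammer ℝ (k - 1 - j)).comp (C ((s - j : ℕ) : ℝ) - X) with hP
  have hdeg : P.natDegree < k := by
    have h1 : (C ((s - j : ℕ) : ℝ) - X : ℝ[X]).natDegree = 1 := by
      rw [natDegree_sub_eq_right_of_natDegree_lt] <;> simp
    rw [hP, natDegree_comp, h1, descPochhammer_natDegree]
    omega
  have hsum : ∀ i ∈ Finset.range (k + 1),
      ∑ x ∈ Finset.range (b + 1),
        poch (-k) i * poch (-(x : ℝ)) i * poch (k - s - 1) i /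
          (poch (-a) i * poch (-b) i * (i ! : ℝ)) *
          (factorialWeight a b c x * ((c + x).descFactorial j : ℝ)) =
        ((s + 1 - k)! : ℝ) / ((a ! : ℝ) * (b ! : ℝ) * ((a + c - j)! : ℝ) * ((b + c - j)! : ℝ)) *
          ((-1) ^ i * (k.choose i : ℝ) * P.eval (i : ℝ)) := by
    intro i hi
    have hi' : i ≤ k := Nat.lt_succ_iff.mp (Finset.mem_range.mp hi)
    have e0 : ∀ x : ℕ, poch (-k) i * poch (-(x : ℝ)) i * poch (k - s - 1) i /
          (poch (-a) i * poch (-b) i * (i ! : ℝ)) *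
          (factorialWeight a b c x * ((c + x).descFactorial j : ℝ)) =
        poch (-k) i * poch (k - s - 1) i / (poch (-a) i * poch (-b) i * (i ! : ℝ)) *
          (poch (-(x : ℝ)) i * ((c + x).descFactorial j : ℝ) * factorialWeight a b c x) := by
      intro x
      ring
    rw [Finset.sum_congr rfl fun x _ => e0 x, ← Finset.mul_sum,
      sum_poch_mul_descFactorial_mul_factorialWeight (by omega) (by omega) (by omega) (by omega)]
    have e1 : (k : ℝ) - s - 1 = -((s + 1 - k : ℕ) : ℝ) := by
      rw [Nat.cast_sub (by omega)]
      push_cast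
      ring
    have e2 : P.eval (i : ℝ) = ((s - i - j)! : ℝ) / ((s + 1 - k - i)! : ℝ) := by
      have : ((s - j : ℕ) : ℝ) - i = ((s - i - j : ℕ) : ℝ) := by
        rw [← Nat.cast_sub (by omega)]
        congr 1
        omega
      rw [hP, eval_comp, eval_sub, eval_C, eval_X, this, descPochhammer_eval_eq_descFactorial,
        cast_descFactorial_eq_div (by omega),
        show s - i - j - (k - 1 - j) = s + 1 - k - i by omega]
    rw [e1, e2]
    simp only [poch_neg_natCast]
    rw [cast_descFactorial_eq_div hi', cast_descFactorial_eq_div (show i ≤ s + 1 - k by omega),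
      cast_descFactorial_eq_div (show i ≤ a by omega),
      cast_descFactorial_eq_div (show i ≤ b by omega), Nat.cast_choose ℝ hi', ← hs]
    have hsq : ((-1 : ℝ) ^ i) ≠ 0 := by simp
    field_simp
  have hcalc : ∀ x ∈ Finset.range (b + 1), factorialWeight a b c x *
      (hahnPoly k a b (s : ℝ)).eval (x : ℝ) * ((c + x).descFactorial j : ℝ) =
      ∑ i ∈ Finset.range (k + 1), poch (-k) i * poch (-(x : ℝ)) i * poch (k - s - 1) i /
          (poch (-a) i * poch (-b) i * (i ! : ℝ)) *
          (factorialWeight a b c x * ((c + x).descFactorial j : ℝ)) := by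
    intro x _
    rw [eval_hahnPoly, Finset.mul_sum, Finset.sum_mul]
    refine Finset.sum_congr rfl fun i _ => ?_
    ring
  rw [Finset.sum_congr rfl hcalc, Finset.sum_comm, Finset.sum_congr rfl hsum, ← Finset.mul_sum,
    sum_choose_mul_eval_eq_zero hdeg, mul_zero]

/-- The falling factorials in `c + x` are monic, one in each degree, so subtracting them removes the
top coefficient of `q` step by step. -/
theorem sum_hahnPoly_mul_eval {a b c k : ℕ} (hka : k ≤ a) (hkb : k ≤ b) {q : ℝ[X]}
    (hq : q.degree < k) :
    ∑ x ∈ Finset.range (b + 1), factorialWeight a b c x *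
      (hahnPoly k a b ((a + b + c : ℕ) : ℝ)).eval (x : ℝ) * q.eval (x : ℝ) = 0 := by
  suffices h : ∀ n ≤ k, ∀ q : ℝ[X], q.degree < n →
      ∑ x ∈ Finset.range (b + 1), factorialWeight a b c x *
        (hahnPoly k a b ((a + b + c : ℕ) : ℝ)).eval (x : ℝ) * q.eval (x : ℝ) = 0 from
    h k le_rfl q hq
  intro n
  induction n with
  | zero =>
    intro _ q hq
    have : q = 0 := by simpa using hq
    simp [this]
  | succ n ih =>
    intro hn q hq
    set d : ℝ[X] := (descPochhammer ℝ n).comp (X + C (c : ℝ)) with hd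
    have hmon : d.Monic := (monic_descPochhammer ℝ n).comp_X_add_C _
    have hnat : d.natDegree = n := by
      rw [hd, natDegree_comp, natDegree_X_add_C, mul_one, descPochhammer_natDegree]
    have hq' : (q - C (q.coeff n) * d).degree < n := by
      rw [degree_lt_iff_coeff_zero]
      intro m hm
      rw [coeff_sub, coeff_C_mul]
      rcases hm.eq_or_lt with rfl | hlt
      · have : d.coeff n = 1 := by
          have := hmon.coeff_natDegree
          rwa [hnat] at this
        rw [this]
        ring
      · rw [(degree_lt_iff_coeff_zero q (n + 1)).mp hq m hlt,
          coeff_eq_zero_of_natDegree_lt (hnat.trans_lt hlt)]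
        ring
    have h := ih (by omega) _ hq'
    have hj := sum_hahnPoly_mul_descFactorial (c := c) hka hkb (show n < k by omega)
    have hdx : ∀ x : ℕ, d.eval (x : ℝ) = ((c + x).descFactorial n : ℝ) := by
      intro x
      rw [hd, eval_comp, ← descPochhammer_eval_eq_descFactorial]
      simp [add_comm]
    have e : ∀ x : ℕ, factorialWeight a b c x *
        (hahnPoly k a b ((a + b + c : ℕ) : ℝ)).eval (x : ℝ) * q.eval (x : ℝ) =
        factorialWeight a b c x * (hahnPoly k a b ((a + b + c : ℕ) : ℝ)).eval (x : ℝ) *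
          (q - C (q.coeff n) * d).eval (x : ℝ) + q.coeff n *
        (factorialWeight a b c x * (hahnPoly k a b ((a + b + c : ℕ) : ℝ)).eval (x : ℝ) *
          ((c + x).descFactorial n : ℝ)) := by
      intro x
      rw [eval_sub, eval_mul, eval_C, hdx]
      ring
    rw [Finset.sum_congr rfl fun x _ => e x, Finset.sum_add_distrib, h, ← Finset.mul_sum, hj]
    simp

theorem natDegree_hahnPoly_le (k a b : ℕ) (s : ℝ) : (hahnPoly k a b s).natDegree ≤ k := by
  refine natDegree_sum_le_of_forall_le _ _ fun i hi => ?_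
  refine (natDegree_C_mul_le _ _).trans ?_
  rw [natDegree_comp, ascPochhammer_natDegree, natDegree_neg, natDegree_X, mul_one]
  exact Nat.lt_succ_iff.mp (Finset.mem_range.mp hi)

/-- Only the term `i = k` reaches degree `k`. Its four negated-integer or negative Pochhammer
factors have signs that cancel, leaving the `(-1)^k` of `(-x)_k`; the hypothesis on `s` makes
`(k-s-1)_k` a product of `k` negative factors. The sign later fixes the square root in the link
coefficient. -/
theorem coeff_hahnPoly_pos {k a b : ℕ} {s : ℝ} (hka : k ≤ a) (hkb : k ≤ b)
    (hs : (2 * k : ℝ) < s + 2) :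
    0 < (-1) ^ k * (hahnPoly k a b s).coeff k := by
  have hc : (hahnPoly k a b s).coeff k =
      poch (-k) k * poch (k - s - 1) k / (poch (-a) k * poch (-b) k * (k ! : ℝ)) * (-1) ^ k := by
    rw [hahnPoly, finsetSum_coeff, Finset.sum_range_succ, Finset.sum_eq_zero, zero_add,
      coeff_C_mul]
    · congr 1
      have hnat : ((ascPochhammer ℝ k).comp (-X)).natDegree = k := by
        rw [natDegree_comp, ascPochhammer_natDegree, natDegree_neg, natDegree_X, mul_one]
      have := coeff_natDegree (p := (ascPochhammer ℝ k).comp (-X))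
      rw [hnat] at this
      rw [this, leadingCoeff_comp (by simp), (monic_ascPochhammer ℝ k).leadingCoeff,
        ascPochhammer_natDegree]
      simp
    · intro i hi
      rw [coeff_C_mul, coeff_eq_zero_of_natDegree_lt, mul_zero]
      rw [natDegree_comp, ascPochhammer_natDegree, natDegree_neg, natDegree_X, mul_one]
      exact Finset.mem_range.mp hi
  have h1 : 0 < (-1) ^ k * poch (k - s - 1) k := by
    have e : (k : ℝ) - s - 1 = -(s + 1 - k) := by ring
    rw [poch, e, ascPochhammer_eval_neg_eq_descPochhammer, ← mul_assoc, ← mul_pow]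
    simp only [mul_neg, mul_one, neg_neg, one_pow, one_mul]
    exact descPochhammer_pos (by linarith)
  have hsq : (-1 : ℝ) ^ k * (-1) ^ k = 1 := by
    rw [← mul_pow]
    simp
  have hd : ∀ {n : ℕ}, k ≤ n → (0 : ℝ) < (n.descFactorial k : ℝ) := fun h =>
    Nat.cast_pos.mpr (Nat.pos_of_ne_zero fun h0 => absurd (Nat.descFactorial_eq_zero_iff_lt.mp h0)
      (not_lt.mpr h))
  have e : (-1) ^ k * (hahnPoly k a b s).coeff k =
      ((-1) ^ k * poch (k - s - 1) k) * (k.descFactorial k : ℝ) /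
        ((a.descFactorial k : ℝ) * (b.descFactorial k : ℝ) * (k ! : ℝ)) := by
    rw [hc, poch_neg_natCast, poch_neg_natCast, poch_neg_natCast]
    have h2 := (hd hka).ne'
    have h3 := (hd hkb).ne'
    have hne : ((-1 : ℝ) ^ k) ≠ 0 := by simp
    field_simp
  rw [e]
  have := hd hka
  have := hd hkb
  have := hd (le_refl k)
  positivity

end Orthogonality

/-! ### The polynomials at each time -/

section HahnSystem

open Polynomial

/-- The `₃F₂` is symmetric in its lower parameters `-M` and `α + 1`. Interchanging them accounts for
the switch between cases I and II, and between III and IV. -/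
theorem hahnQ_eq_eval_hahnPoly {k a b : ℕ} {x α β M s : ℝ} (hs : α + β = -s - 2)
    (h : (M = a ∧ α = -b - 1) ∨ (M = b ∧ α = -a - 1)) :
    hahnQ k x α β M = (hahnPoly k a b s).eval x := by
  rw [hahnQ, eval_hahnPoly]
  refine Finset.sum_congr rfl fun i _ => ?_
  have e : (k : ℝ) + α + β + 1 = k - s - 1 := by linarith
  rw [e]
  rcases h with ⟨rfl, rfl⟩ | ⟨rfl, rfl⟩
  · rw [show -(b : ℝ) - 1 + 1 = -b by ring]
  · rw [show -(a : ℝ) - 1 + 1 = -a by ring, mul_comm (poch (-(b : ℝ)) i)]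

theorem sum_Icc_int_eq_sum_range (d : ℤ) (m : ℕ) (F : ℤ → ℝ) :
    ∑ x ∈ Finset.Icc d (d + m), F x = ∑ n ∈ Finset.range (m + 1), F (d + n) := by
  symm
  refine Finset.sum_nbij' (fun n => d + (n : ℤ)) (fun x => (x - d).toNat) ?_ ?_ ?_ ?_ ?_
  · intro n hn
    have := Finset.mem_range.mp hn
    rw [Finset.mem_Icc]
    omega
  · intro x hx
    have := Finset.mem_Icc.mp hx
    rw [Finset.mem_range]
    omega
  · intro n _
    simp
  · intro x hx
    have := Finset.mem_Icc.mp hx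
    omega
  · intro n _
    rfl

/-- All that is needed later about the Hahn polynomials, free of the case distinction: degree, sign
of the top coefficient, and orthogonality to lower degrees. -/
theorem exists_polynomial_hahnH {N T S t k : ℕ} (hN : 1 ≤ N) (hS : S ≤ T) (ht : t ≤ T)
    (hk : (k : ℤ) ≤ hahnM N T S t) :
    ∃ p : ℝ[X], p.natDegree ≤ k ∧ 0 < (-1) ^ k * p.coeff k ∧
      (∀ x : ℤ, hahnH N T S t k x = p.eval (x : ℝ)) ∧
      ∀ q : ℝ[X], q.degree < k →
        ∑ x ∈ hahnSupport N T S t,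
          hahnWeight N T S t x * p.eval (x : ℝ) * q.eval (x : ℝ) = 0 := by
  by_cases h : t + S ≤ T
  -- Cases I and II: `a = t+N-1`, `b = S+N-1`, `c = T-t-S`. The weight is already `factorialWeight a
  -- b c`.
  · obtain ⟨c, rfl⟩ := Nat.exists_eq_add_of_le h
    obtain ⟨n, rfl⟩ := Nat.exists_eq_add_of_le' hN
    have hka : k ≤ t + n := by
      rw [hahnM, if_pos h] at hk
      split_ifs at hk <;> omega
    have hkb : k ≤ S + n := by
      rw [hahnM, if_pos h] at hk
      split_ifs at hk <;> omega
    refine ⟨hahnPoly k (t + n) (S + n) ((t + n + (S + n) + c : ℕ) : ℝ),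
      natDegree_hahnPoly_le .., coeff_hahnPoly_pos hka hkb ?_, fun x => ?_, fun q hq => ?_⟩
    · have : 2 * k < t + n + (S + n) + c + 2 := by omega
      exact_mod_cast this
    · rw [hahnH, hahnShift, if_pos h]
      apply hahnQ_eq_eval_hahnPoly
      · rw [hahnAlpha, hahnBeta, if_pos h, if_pos h]
        split_ifs <;> push_cast <;> ring
      · rw [hahnAlpha, hahnM, if_pos h, if_pos h]
        split_ifs
        · left
          push_cast
          constructor <;> ring
        · right
          push_cast
          constructor <;> ring
    · rw [← sum_hahnPoly_mul_eval (c := c) hka hkb hq]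
      have hsupp : hahnSupport (n + 1) (t + S + c) S t =
          Finset.Icc (0 : ℤ) (0 + (min (t + n) (S + n) : ℕ)) := by
        rw [hahnSupport]
        congr 1 <;> omega
      rw [hsupp, sum_Icc_int_eq_sum_range]
      rw [← Finset.sum_subset (Finset.range_subset_range.mpr
        (show min (t + n) (S + n) + 1 ≤ S + n + 1 by omega))]
      · refine Finset.sum_congr rfl fun x hx => ?_
        have hx' := Finset.mem_range.mp hx
        have hmem : (0 + (x : ℤ)) ∈ hahnSupport (n + 1) (t + S + c) S t := by
          rw [hsupp, Finset.mem_Icc]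
          omega
        rw [hahnWeight, if_pos hmem, factorialWeight, if_pos (by omega)]
        have e1 : (0 + (x : ℤ)).toNat = x := by omega
        have e2 : ((t : ℤ) + (n + 1 : ℕ) - 1 - (0 + x)).toNat = t + n - x := by omega
        have e3 : ((S : ℤ) + (n + 1 : ℕ) - 1 - (0 + x)).toNat = S + n - x := by omega
        have e4 : (((t + S + c : ℕ) : ℤ) - t - S + (0 + x)).toNat = c + x := by omega
        rw [e1, e2, e3, e4]
        simp
      · intro x hx hx'
        rw [Finset.mem_range] at hx hx'
        rw [factorialWeight, if_neg (by omega)]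
        simp
  -- Cases III and IV: `d = t+S-T`, `e = T-S`, `u = T-t`. In the variable `x - d` the weight is
  -- `factorialWeight (e+n) (u+n) d` with `n = N-1`.
  · obtain ⟨n, rfl⟩ := Nat.exists_eq_add_of_le' hN
    obtain ⟨u, rfl⟩ := Nat.exists_eq_add_of_le ht
    obtain ⟨d, rfl⟩ : ∃ d, S = u + d := Nat.exists_eq_add_of_le (by omega)
    have hka : k ≤ t - d + n := by
      rw [hahnM, if_neg h] at hk
      split_ifs at hk <;> omega
    have hkb : k ≤ u + n := by
      rw [hahnM, if_neg h] at hk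
      split_ifs at hk <;> omega
    have hdt : d ≤ t := by omega
    obtain ⟨e, rfl⟩ := Nat.exists_eq_add_of_le hdt
    rw [show d + e - d + n = e + n by omega] at hka
    set s : ℝ := ((e + n + (u + n) + d : ℕ) : ℝ) with hs
    set P := hahnPoly k (e + n) (u + n) s with hP
    have hcoeff : ((P.comp (X - C (d : ℝ))).coeff k) = P.coeff k := by
      have hpos := coeff_hahnPoly_pos (s := s) hka hkb (by
        have : 2 * k < e + n + (u + n) + d + 2 := by omega
        rw [hs]
        exact_mod_cast this)
      have hdeg : P.natDegree = k := by
        refine le_antisymm (natDegree_hahnPoly_le ..) (le_natDegree_of_ne_zero ?_)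
        intro h0
        rw [← hP, h0, mul_zero] at hpos
        exact lt_irrefl _ hpos
      have h1 : (P.comp (X - C (d : ℝ))).natDegree = k := by
        rw [natDegree_comp, natDegree_X_sub_C, mul_one, hdeg]
      have h2 := leadingCoeff_comp (p := P) (q := X - C (d : ℝ))
        (by rw [natDegree_X_sub_C]; exact one_ne_zero)
      rw [leadingCoeff, h1, leadingCoeff_X_sub_C, one_pow, mul_one, leadingCoeff, hdeg] at h2
      exact h2
    refine ⟨P.comp (X - C (d : ℝ)), ?_, ?_, fun x => ?_, fun q hq => ?_⟩
    · rw [natDegree_comp, natDegree_X_sub_C, mul_one]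
      exact natDegree_hahnPoly_le ..
    · rw [hcoeff]
      apply coeff_hahnPoly_pos hka hkb
      have : 2 * k < e + n + (u + n) + d + 2 := by omega
      rw [hs]
      exact_mod_cast this
    · rw [hahnH, hahnShift, if_neg h, eval_comp, eval_sub, eval_X, eval_C]
      have hx : (((((d + e + u : ℕ) : ℤ) - (d + e : ℕ) - (u + d : ℕ) + x : ℤ)) : ℝ) = x - d := by
        push_cast
        ring
      rw [hx]
      apply hahnQ_eq_eval_hahnPoly
      · rw [hahnAlpha, hahnBeta, if_neg h, if_neg h]
        split_ifs <;> push_cast [hs] <;> ring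
      · rw [hahnAlpha, hahnM, if_neg h, if_neg h]
        split_ifs
        · left
          push_cast
          constructor <;> ring
        · right
          push_cast
          constructor <;> ring
    · have hq' : (q.comp (X + C (d : ℝ))).degree < k := by
        rw [← taylor_apply, degree_taylor]
        exact hq
      rw [← sum_hahnPoly_mul_eval (c := d) hka hkb hq']
      have hsupp : hahnSupport (n + 1) (d + e + u) (u + d) (d + e) =
          Finset.Icc (d : ℤ) (d + (min (e + n) (u + n) : ℕ)) := by
        rw [hahnSupport]
        congr 1 <;> omega
      rw [hsupp, sum_Icc_int_eq_sum_range]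
      rw [← Finset.sum_subset (Finset.range_subset_range.mpr
        (show min (e + n) (u + n) + 1 ≤ u + n + 1 by omega))]
      · refine Finset.sum_congr rfl fun x hx => ?_
        have hx' := Finset.mem_range.mp hx
        have hmem : ((d : ℤ) + (x : ℤ)) ∈ hahnSupport (n + 1) (d + e + u) (u + d) (d + e) := by
          rw [hsupp, Finset.mem_Icc]
          omega
        rw [hahnWeight, if_pos hmem, factorialWeight, if_pos (by omega)]
        have e1 : ((d : ℤ) + (x : ℤ)).toNat = d + x := by omega
        have e2 : (((d + e : ℕ) : ℤ) + (n + 1 : ℕ) - 1 - (d + x)).toNat = e + n - x := by omega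
        have e3 : (((u + d : ℕ) : ℤ) + (n + 1 : ℕ) - 1 - (d + x)).toNat = u + n - x := by omega
        have e4 : (((d + e + u : ℕ) : ℤ) - (d + e : ℕ) - (u + d : ℕ) + (d + x)).toNat = x := by
          omega
        rw [e1, e2, e3, e4, ← hs, ← hP]
        simp only [eval_comp, eval_sub, eval_add, eval_X, eval_C]
        push_cast
        rw [show (d : ℝ) + x - d = x by ring, add_comm (x : ℝ) d]
        congr 2
        ring
      · intro x hx hx'
        rw [Finset.mem_range] at hx hx'
        rw [factorialWeight, if_neg (by omega)]
        simp

end HahnSystem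

/-! ### Orthonormality -/

section Orthonormality

open Polynomial

theorem hahnM_eq {N T S t : ℕ} :
    hahnM N T S t = min ((t : ℤ) + N - 1) ((S : ℤ) + N - 1) - max 0 ((t : ℤ) + S - T) := by
  rw [hahnM]
  split_ifs <;> omega

theorem card_hahnSupport {N T S t : ℕ} (hN : 1 ≤ N) (hS : S ≤ T) (ht : t ≤ T) :
    ((hahnSupport N T S t).card : ℤ) = hahnM N T S t + 1 := by
  rw [hahnSupport, Int.card_Icc, hahnM_eq]
  omega

theorem hahnWeight_pos {N T S t : ℕ} {x : ℤ} (hx : x ∈ hahnSupport N T S t) :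
    0 < hahnWeight N T S t x := by
  rw [hahnWeight, if_pos hx]
  positivity

theorem hahnWeight_nonneg (N T S t : ℕ) (x : ℤ) : 0 ≤ hahnWeight N T S t x := by
  rw [hahnWeight]
  split_ifs <;> positivity

/-- A zero norm would give a polynomial of degree at most `k ≤ M` with `M + 1` roots, contradicting
its nonzero top coefficient. -/
theorem hahnNormSq_pos {N T S t k : ℕ} (hN : 1 ≤ N) (hS : S ≤ T) (ht : t ≤ T)
    (hk : (k : ℤ) ≤ hahnM N T S t) : 0 < hahnNormSq N T S t k := by
  obtain ⟨p, hdeg, hcoeff, hp, -⟩ := exists_polynomial_hahnH hN hS ht hk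
  have hnn : ∀ x ∈ hahnSupport N T S t, 0 ≤ hahnH N T S t k x ^ 2 * hahnWeight N T S t x :=
    fun x _ => mul_nonneg (sq_nonneg _) (hahnWeight_nonneg ..)
  refine (Finset.sum_nonneg hnn).lt_of_ne fun h0 => ?_
  have hz := (Finset.sum_eq_zero_iff_of_nonneg hnn).mp h0.symm
  have : p = 0 := by
    refine Polynomial.eq_zero_of_natDegree_lt_card_of_eval_eq_zero' p
      ((hahnSupport N T S t).image fun x : ℤ => (x : ℝ)) ?_ ?_
    · intro y hy
      obtain ⟨x, hx, rfl⟩ := Finset.mem_image.mp hy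
      rw [← hp]
      have := hz x hx
      rw [mul_eq_zero, or_iff_left (hahnWeight_pos hx).ne'] at this
      exact pow_eq_zero_iff two_ne_zero |>.mp this
    · rw [Finset.card_image_of_injective _ Int.cast_injective]
      have := card_hahnSupport hN hS ht
      omega
  rw [this] at hcoeff
  simp at hcoeff

theorem sum_hahnH_mul_hahnH_mul_hahnWeight_of_ne {N T S t m n : ℕ} (hN : 1 ≤ N) (hS : S ≤ T)
    (ht : t ≤ T) (hm : (m : ℤ) ≤ hahnM N T S t) (hn : (n : ℤ) ≤ hahnM N T S t) (hmn : m ≠ n) :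
    ∑ x ∈ hahnSupport N T S t, hahnH N T S t m x * hahnH N T S t n x * hahnWeight N T S t x =
      0 := by
  wlog h : m < n generalizing m n
  · rw [← this hn hm hmn.symm (by omega)]
    refine Finset.sum_congr rfl fun x _ => ?_
    ring
  obtain ⟨p, hpd, -, hp, -⟩ := exists_polynomial_hahnH hN hS ht hm
  obtain ⟨q, -, -, hq, horth⟩ := exists_polynomial_hahnH hN hS ht hn
  rw [← horth p ((degree_le_of_natDegree_le hpd).trans_lt (by exact_mod_cast h))]
  refine Finset.sum_congr rfl fun x _ => ?_
  rw [hp, hq]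
  ring

theorem hahnF_eq {N T S t n : ℕ} (hn : (n : ℤ) ≤ hahnM N T S t) (x : ℤ) :
    hahnF N T S t n x =
      hahnH N T S t n x * Real.sqrt (hahnWeight N T S t x) / Real.sqrt (hahnNormSq N T S t n) :=
  if_pos hn

theorem hahnF_eq_zero_of_lt {N T S t n : ℕ} (hn : hahnM N T S t < n) (x : ℤ) :
    hahnF N T S t n x = 0 :=
  if_neg (not_le.mpr hn)

theorem hahnF_eq_zero_of_notMem {N T S t n : ℕ} {x : ℤ} (hx : x ∉ hahnSupport N T S t) :
    hahnF N T S t n x = 0 := by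
  rw [hahnF, hahnWeight, if_neg hx]
  simp

theorem sum_hahnF_mul_hahnF {N T S t m n : ℕ} (hN : 1 ≤ N) (hS : S ≤ T) (ht : t ≤ T)
    (hm : (m : ℤ) ≤ hahnM N T S t) (hn : (n : ℤ) ≤ hahnM N T S t) :
    ∑ x ∈ hahnSupport N T S t, hahnF N T S t m x * hahnF N T S t n x =
      if m = n then 1 else 0 := by
  have e : ∀ x, hahnF N T S t m x * hahnF N T S t n x =
      hahnH N T S t m x * hahnH N T S t n x * hahnWeight N T S t x /
        (Real.sqrt (hahnNormSq N T S t m) * Real.sqrt (hahnNormSq N T S t n)) := by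
    intro x
    rw [hahnF_eq hm, hahnF_eq hn, div_mul_div_comm]
    congr 1
    rw [mul_mul_mul_comm, Real.mul_self_sqrt (hahnWeight_nonneg ..)]
  rw [Finset.sum_congr rfl fun x _ => e x, ← Finset.sum_div]
  split_ifs with h
  · subst h
    have hpos := hahnNormSq_pos hN hS ht hm
    rw [Real.mul_self_sqrt hpos.le, div_eq_one_iff_eq hpos.ne', hahnNormSq]
    refine Finset.sum_congr rfl fun x _ => ?_
    ring
  · rw [sum_hahnH_mul_hahnH_mul_hahnWeight_of_ne hN hS ht hm hn h, zero_div]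

theorem hahnM_lt {N T S t : ℕ} (hN : 1 ≤ N) :
    hahnM N T S t < ((S + N - 1 + 1 : ℕ) : ℤ) := by
  rw [hahnM_eq]
  omega

/-- Completeness from orthonormality: the matrix of the functions is square, so a one-sided inverse
is two-sided. Indices beyond `M` contribute zero. -/
theorem sum_hahnF_mul_hahnF_eq_delta {N T S t : ℕ} (hN : 1 ≤ N) (hS : S ≤ T) (ht : t ≤ T)
    {x y : ℤ} (hx : x ∈ hahnSupport N T S t) (hy : y ∈ hahnSupport N T S t) :
    ∑ n ∈ Finset.range (S + N - 1 + 1), hahnF N T S t n x * hahnF N T S t n y =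
      if x = y then 1 else 0 := by
  set A := hahnSupport N T S t with hA
  have hcard : (A.card : ℤ) = hahnM N T S t + 1 := card_hahnSupport hN hS ht
  let F : Matrix (Fin A.card) A ℝ := Matrix.of fun n x => hahnF N T S t n x
  have hFF : F * F.transpose = 1 := by
    ext m n
    rw [Matrix.mul_apply]
    simp only [F, Matrix.transpose_apply, Matrix.of_apply]
    rw [Finset.sum_coe_sort A fun x => hahnF N T S t m x * hahnF N T S t n x,
      sum_hahnF_mul_hahnF hN hS ht (by omega) (by omega), Matrix.one_apply]
    simp [Fin.ext_iff]
  have hFF' : F.transpose * F = 1 :=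
    (Matrix.mul_eq_one_comm_of_card_eq _ _ _ (by simp)).mp hFF
  have h := congrFun (congrFun hFF' ⟨x, hx⟩) ⟨y, hy⟩
  rw [Matrix.mul_apply, Matrix.one_apply] at h
  simp only [F, Matrix.transpose_apply, Matrix.of_apply, Subtype.mk.injEq] at h
  rw [← h, Fin.sum_univ_eq_sum_range fun n => hahnF N T S t n x * hahnF N T S t n y]
  have hlt := hahnM_lt (T := T) (S := S) (t := t) hN
  symm
  refine Finset.sum_subset (Finset.range_subset_range.mpr (by omega)) fun n _ hn => ?_
  rw [Finset.mem_range] at hn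
  rw [hahnF_eq_zero_of_lt (by omega), zero_mul]

end Orthonormality

/-! ### The link between consecutive times -/

section Link

open Polynomial

/-- Balance relation for the step `x → x`; `hahnWeight_mul_move` is its analogue for `x → x + 1`.
Where just one of the two weights lives, its linear factor vanishes, so no boundary terms arise. -/
theorem hahnWeight_mul_stay {N T S t : ℕ} (x : ℤ) :
    hahnWeight N T S t x * ((T : ℝ) - t - S + x) =
      hahnWeight N T S (t + 1) x * ((t : ℝ) + N - x) := by
  by_cases h1 : x ∈ hahnSupport N T S t
  · by_cases h2 : x ∈ hahnSupport N T S (t + 1)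
    · rw [hahnWeight, hahnWeight, if_pos h1, if_pos h2]
      rw [hahnSupport, Finset.mem_Icc] at h1 h2
      obtain ⟨a, ha⟩ : ∃ a : ℕ, (t : ℤ) + N - 1 - x = a := ⟨_, (Int.toNat_of_nonneg (by omega)).symm⟩
      obtain ⟨b, hb⟩ : ∃ b : ℕ, (T : ℤ) - (t + 1 : ℕ) - S + x = b :=
        ⟨_, (Int.toNat_of_nonneg (by omega)).symm⟩
      rw [show ((t + 1 : ℕ) : ℤ) + N - 1 - x = (a + 1 : ℕ) by omega,
        show (T : ℤ) - t - S + x = (b + 1 : ℕ) by omega, ha, hb]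
      have ha' : (t : ℝ) + N - x = (a + 1 : ℕ) := by
        have : (t : ℤ) + N - x = (a + 1 : ℕ) := by omega
        exact_mod_cast this
      have hb' : (T : ℝ) - t - S + x = (b + 1 : ℕ) := by
        have : (T : ℤ) - t - S + x = (b + 1 : ℕ) := by omega
        exact_mod_cast this
      rw [ha', hb']
      simp only [Int.toNat_natCast, Nat.factorial_succ]
      push_cast
      field_simp
    · have : (T : ℤ) - t - S + x = 0 := by
        rw [hahnSupport, Finset.mem_Icc] at h1 h2
        omega
      have : (T : ℝ) - t - S + x = 0 := by exact_mod_cast this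
      rw [this, hahnWeight, hahnWeight, if_neg h2]
      ring
  · by_cases h2 : x ∈ hahnSupport N T S (t + 1)
    · have : (t : ℤ) + N - x = 0 := by
        rw [hahnSupport, Finset.mem_Icc] at h1 h2
        omega
      have : (t : ℝ) + N - x = 0 := by exact_mod_cast this
      rw [this, hahnWeight, hahnWeight, if_neg h1]
      ring
    · rw [hahnWeight, hahnWeight, if_neg h1, if_neg h2]
      ring

theorem hahnWeight_mul_move {N T S t : ℕ} (hN : 1 ≤ N) (x : ℤ) :
    hahnWeight N T S t x * ((S : ℝ) + N - 1 - x) =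
      hahnWeight N T S (t + 1) (x + 1) * ((x : ℝ) + 1) := by
  by_cases h1 : x ∈ hahnSupport N T S t
  · by_cases h2 : x + 1 ∈ hahnSupport N T S (t + 1)
    · rw [hahnWeight, hahnWeight, if_pos h1, if_pos h2]
      rw [hahnSupport, Finset.mem_Icc] at h1 h2
      obtain ⟨a, ha⟩ : ∃ a : ℕ, (S : ℤ) + N - 1 - (x + 1) = a :=
        ⟨_, (Int.toNat_of_nonneg (by omega)).symm⟩
      obtain ⟨b, hb⟩ : ∃ b : ℕ, x = b := ⟨_, (Int.toNat_of_nonneg (by omega)).symm⟩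
      rw [show ((t + 1 : ℕ) : ℤ) + N - 1 - (x + 1) = (t : ℤ) + N - 1 - x by omega,
        show (T : ℤ) - (t + 1 : ℕ) - S + (x + 1) = (T : ℤ) - t - S + x by omega,
        show (S : ℤ) + N - 1 - x = (a + 1 : ℕ) by omega,
        ha, show x + 1 = (b + 1 : ℕ) by omega]
      have ha' : (S : ℝ) + N - 1 - x = (a + 1 : ℕ) := by
        have : (S : ℤ) + N - 1 - x = (a + 1 : ℕ) := by omega
        exact_mod_cast this
      rw [ha', hb]
      simp only [Int.toNat_natCast, Nat.factorial_succ]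
      push_cast
      field_simp
    · have : (S : ℤ) + N - 1 - x = 0 := by
        rw [hahnSupport, Finset.mem_Icc] at h1 h2
        omega
      have : (S : ℝ) + N - 1 - x = 0 := by exact_mod_cast this
      rw [this, hahnWeight, hahnWeight, if_neg h2]
      ring
  · by_cases h2 : x + 1 ∈ hahnSupport N T S (t + 1)
    · have : x + 1 = 0 := by
        rw [hahnSupport, Finset.mem_Icc] at h1 h2
        omega
      have : (x : ℝ) + 1 = 0 := by exact_mod_cast this
      rw [this, hahnWeight, hahnWeight, if_neg h1]
      ring
    · rw [hahnWeight, hahnWeight, if_neg h1, if_neg h2]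
      ring

/-- The backward and forward one-step operators are adjoint to each other. -/
theorem sum_hahnWeight_step_adjoint {N T S t : ℕ} (hN : 1 ≤ N) (φ ψ : ℤ → ℝ) :
    ∑ x ∈ hahnSupport N T S t, hahnWeight N T S t x * φ x *
        (((T : ℝ) - t - S + x) * ψ x + ((S : ℝ) + N - 1 - x) * ψ (x + 1)) =
      ∑ y ∈ hahnSupport N T S (t + 1), hahnWeight N T S (t + 1) y * ψ y *
        (((t : ℝ) + N - y) * φ y + y * φ (y - 1)) := by
  -- Summing over all of `ℤ` makes the shift `y = x + 1` a bijection, with no end points to track.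
  have hw : ∀ (t' : ℕ) (g : ℤ → ℝ),
      ∑ x ∈ hahnSupport N T S t', hahnWeight N T S t' x * g x =
        ∑ᶠ x, hahnWeight N T S t' x * g x := by
    intro t' g
    symm
    refine finsum_eq_sum_of_support_subset _ fun x hx => ?_
    by_contra hmem
    apply hx
    have h0 : hahnWeight N T S t' x = 0 := if_neg (by simpa using hmem)
    simp only [h0, zero_mul]
  have e1 : ∀ x : ℤ, hahnWeight N T S t x * φ x *
        (((T : ℝ) - t - S + x) * ψ x + ((S : ℝ) + N - 1 - x) * ψ (x + 1)) =
      hahnWeight N T S t x * (((T : ℝ) - t - S + x) * (φ x * ψ x)) +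
        hahnWeight N T S t x * (((S : ℝ) + N - 1 - x) * (φ x * ψ (x + 1))) := fun x => by ring
  have e2 : ∀ y : ℤ, hahnWeight N T S (t + 1) y * ψ y *
        (((t : ℝ) + N - y) * φ y + y * φ (y - 1)) =
      hahnWeight N T S (t + 1) y * (((t : ℝ) + N - y) * (φ y * ψ y)) +
        hahnWeight N T S (t + 1) y * (y * (φ (y - 1) * ψ y)) := fun x => by ring
  rw [Finset.sum_congr rfl fun x _ => e1 x, Finset.sum_congr rfl fun y _ => e2 y,
    Finset.sum_add_distrib, Finset.sum_add_distrib, hw, hw, hw, hw]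
  congr 1
  · refine finsum_congr fun x => ?_
    rw [← mul_assoc, hahnWeight_mul_stay, mul_assoc]
  · rw [← finsum_comp_equiv (Equiv.addRight (1 : ℤ))
      (f := fun y : ℤ => hahnWeight N T S (t + 1) y * (y * (φ (y - 1) * ψ y)))]
    refine finsum_congr fun x => ?_
    simp only [Equiv.coe_addRight, add_sub_cancel_right]
    rw [← mul_assoc, hahnWeight_mul_move hN]
    push_cast
    ring

/-- The difference operator `p ↦ (x + A) p(x) + (B - x) p(x + r)` preserves degrees. -/
theorem natDegree_step_le_and_coeff (A B r : ℝ) {p : ℝ[X]} {n : ℕ} (hp : p.natDegree ≤ n) :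
    ((X + C A) * p + (C B - X) * taylor r p).natDegree ≤ n ∧
      ((X + C A) * p + (C B - X) * taylor r p).coeff n = (A + B - r * n) * p.coeff n := by
  have htd : (taylor r p).natDegree ≤ n := by rwa [natDegree_taylor]
  have htn : (taylor r p).coeff n = p.coeff n := by
    rw [taylor_coeff, eval_eq_sum_range' (n := 1)]
    · simp [hasseDeriv_coeff]
    · have := natDegree_hasseDeriv_le p n
      omega
  have hpz : ∀ j, n < j → p.coeff j = 0 := fun j hj =>
    coeff_eq_zero_of_natDegree_lt (hp.trans_lt hj)
  have htz : ∀ j, n < j → (taylor r p).coeff j = 0 := fun j hj =>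
    coeff_eq_zero_of_natDegree_lt (htd.trans_lt hj)
  constructor
  -- In degree `n + 1` the leading terms of `x p(x)` and `-x p(x+r)` cancel.
  · rw [natDegree_le_iff_coeff_eq_zero]
    intro j hj
    obtain ⟨i, rfl⟩ : ∃ i, j = i + 1 := ⟨j - 1, by omega⟩
    rw [coeff_add, add_mul, sub_mul, coeff_add, coeff_sub, coeff_C_mul, coeff_C_mul, coeff_X_mul,
      coeff_X_mul, hpz _ hj, htz _ hj]
    rcases (Nat.lt_succ_iff.mp hj).eq_or_lt with h | h
    · subst h
      rw [htn]
      ring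
    · rw [hpz _ h, htz _ h]
      ring
  · rw [coeff_add, add_mul, sub_mul, coeff_add, coeff_sub, coeff_C_mul, coeff_C_mul, htn]
    cases n with
    | zero => simp [mul_coeff_zero]; ring
    | succ n =>
      -- The second coefficient of `p(x+r)` is the source of the correction `-r n` in the factor.
      have htp : (taylor r p).coeff n = p.coeff n + (n + 1) * r * p.coeff (n + 1) := by
        rw [taylor_coeff, eval_eq_sum_range' (n := 2)]
        · simp [hasseDeriv_coeff, Finset.sum_range_succ, add_comm 1 n]
          ring
        · have := natDegree_hasseDeriv_le p n
          omega
      rw [coeff_X_mul, coeff_X_mul, htp]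
      push_cast
      ring

/-- After a multiple of `p` with the same top coefficient is subtracted from `b`, the remainder has
degree below `k` and is orthogonal to `p`. -/
theorem sum_hahnWeight_mul_hahnH_mul_eval {N T S t k : ℕ} {p : ℝ[X]} (hdeg : p.natDegree ≤ k)
    (hcoeff : 0 < (-1) ^ k * p.coeff k) (hp : ∀ x : ℤ, hahnH N T S t k x = p.eval (x : ℝ))
    (horth : ∀ q : ℝ[X], q.degree < k → ∑ x ∈ hahnSupport N T S t,
      hahnWeight N T S t x * p.eval (x : ℝ) * q.eval (x : ℝ) = 0)
    {b : ℝ[X]} (hb : b.natDegree ≤ k) :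
    ∑ x ∈ hahnSupport N T S t, hahnWeight N T S t x * hahnH N T S t k x * b.eval (x : ℝ) =
      b.coeff k / p.coeff k * hahnNormSq N T S t k := by
  have hne : p.coeff k ≠ 0 := fun h => by simp [h] at hcoeff
  have hlt : (b - C (b.coeff k / p.coeff k) * p).degree < k := by
    rw [degree_lt_iff_coeff_zero]
    intro m hm
    rw [coeff_sub, coeff_C_mul]
    rcases hm.eq_or_lt with rfl | h
    · field_simp
      ring
    · rw [coeff_eq_zero_of_natDegree_lt (hb.trans_lt h),
        coeff_eq_zero_of_natDegree_lt (hdeg.trans_lt h)]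
      ring
  have h := horth _ hlt
  rw [hahnNormSq, Finset.mul_sum, ← sub_eq_zero, ← Finset.sum_sub_distrib, ← h]
  refine Finset.sum_congr rfl fun x _ => ?_
  rw [hp, eval_sub, eval_mul, eval_C]
  ring

/-- For `m > n` the operator applied to `H^{t+1}_n` has degree below `m`; for `m < n` its adjoint
applied to `H^t_m` has degree below `n`. Both entries vanish by orthogonality. On the diagonal the
two evaluations involve inverse ratios of leading coefficients, which cancel in the product. -/
theorem sum_hahnH_step_hahnH {N T S t m n : ℕ} (hN : 1 ≤ N) (hS : S ≤ T) (ht : t < T)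
    (hm : (m : ℤ) ≤ hahnM N T S t) (hn : (n : ℤ) ≤ hahnM N T S (t + 1)) :
    ∑ x ∈ hahnSupport N T S t, hahnWeight N T S t x * hahnH N T S t m x *
        (((T : ℝ) - t - S + x) * hahnH N T S (t + 1) n x +
          ((S : ℝ) + N - 1 - x) * hahnH N T S (t + 1) n (x + 1)) =
      if m = n then Real.sqrt (((t : ℝ) + N - n) * ((T : ℝ) + N - t - 1 - n)) *
        Real.sqrt (hahnNormSq N T S t m) * Real.sqrt (hahnNormSq N T S (t + 1) n) else 0 := by
  obtain ⟨p, hpd, hpc, hp, hpo⟩ := exists_polynomial_hahnH hN hS ht.le hm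
  obtain ⟨q, hqd, hqc, hq, hqo⟩ := exists_polynomial_hahnH hN hS ht hn
  set I := ∑ x ∈ hahnSupport N T S t, hahnWeight N T S t x * hahnH N T S t m x *
        (((T : ℝ) - t - S + x) * hahnH N T S (t + 1) n x +
          ((S : ℝ) + N - 1 - x) * hahnH N T S (t + 1) n (x + 1)) with hI
  obtain ⟨hbd, hbc⟩ := natDegree_step_le_and_coeff ((T : ℝ) - t - S) ((S : ℝ) + N - 1) 1 hqd
  set b := (X + C ((T : ℝ) - t - S)) * q + (C ((S : ℝ) + N - 1) - X) * taylor 1 q with hb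
  have hIb : I = ∑ x ∈ hahnSupport N T S t,
      hahnWeight N T S t x * hahnH N T S t m x * b.eval (x : ℝ) := by
    refine Finset.sum_congr rfl fun x _ => ?_
    rw [hq, hq, hb]
    simp only [eval_add, eval_sub, eval_mul, eval_X, eval_C, taylor_eval]
    push_cast
    ring
  -- The adjoint is minus an operator of the same shape, with `A = -(t+N)`, `B = 0`, `r = -1`; hence
  -- the `-d` below.
  obtain ⟨hdd, hdc⟩ := natDegree_step_le_and_coeff (-((t : ℝ) + N)) 0 (-1) hpd
  set d := (X + C (-((t : ℝ) + N))) * p + (C 0 - X) * taylor (-1) p with hd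
  have hId : I = ∑ y ∈ hahnSupport N T S (t + 1),
      hahnWeight N T S (t + 1) y * hahnH N T S (t + 1) n y * (-d).eval (y : ℝ) := by
    rw [hI, sum_hahnWeight_step_adjoint hN]
    refine Finset.sum_congr rfl fun x _ => ?_
    rw [hp, hp, hd]
    simp only [eval_add, eval_sub, eval_mul, eval_X, eval_C, taylor_eval, eval_neg]
    push_cast
    rw [← sub_eq_add_neg]
    ring_nf
  rcases lt_trichotomy m n with hlt | rfl | hlt
  · rw [if_neg hlt.ne, hId, ← hqo (-d)]
    · refine Finset.sum_congr rfl fun x _ => ?_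
      rw [hq]
    · rw [degree_neg]
      exact (degree_le_of_natDegree_le hdd).trans_lt (by exact_mod_cast hlt)
  · rw [if_pos rfl]
    rw [sum_hahnWeight_mul_hahnH_mul_eval hpd hpc hp hpo hbd, hbc] at hIb
    rw [sum_hahnWeight_mul_hahnH_mul_eval hqd hqc hq hqo
      (by rwa [natDegree_neg]), coeff_neg, hdc] at hId
    have hn1 := hahnNormSq_pos hN hS ht.le hm
    have hn2 := hahnNormSq_pos hN hS ht hn
    have hsq : ((-1 : ℝ) ^ m) * (-1) ^ m = 1 := by rw [← mul_pow]; simp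
    have hpne : p.coeff m ≠ 0 := fun h => by simp [h] at hpc
    have hqne : q.coeff m ≠ 0 := fun h => by simp [h] at hqc
    have hpq : 0 < q.coeff m / p.coeff m := by
      have : q.coeff m / p.coeff m = ((-1) ^ m * q.coeff m) / ((-1) ^ m * p.coeff m) := by
        rw [mul_div_mul_left]
        simp
      rw [this]
      exact div_pos hqc hpc
    have h1 : (0 : ℝ) ≤ (t : ℝ) + N - m := by
      rw [hahnM_eq] at hm
      have : (0 : ℤ) ≤ (t : ℤ) + N - m := by omega
      exact_mod_cast this
    have h2 : (0 : ℝ) ≤ (T : ℝ) + N - t - 1 - m := by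
      rw [hahnM_eq] at hn
      have : (0 : ℤ) ≤ (T : ℤ) + N - t - 1 - m := by omega
      exact_mod_cast this
    have hInn : 0 ≤ I := by
      have : I = ((T : ℝ) + N - t - 1 - m) * (q.coeff m / p.coeff m) * hahnNormSq N T S t m := by
        rw [hIb]
        ring
      rw [this]
      positivity
    -- One factor `I` is evaluated at time `t`, the other at time `t + 1`.
    have hII : I ^ 2 = (((t : ℝ) + N - m) * ((T : ℝ) + N - t - 1 - m)) *
        hahnNormSq N T S t m * hahnNormSq N T S (t + 1) m := by
      rw [sq]
      nth_rewrite 1 [hIb]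
      rw [hId]
      field_simp
      ring
    rw [← Real.sqrt_mul (mul_nonneg h1 h2), ← Real.sqrt_mul (mul_nonneg (mul_nonneg h1 h2) hn1.le),
      ← hII, Real.sqrt_sq hInn]
  · rw [if_neg hlt.ne', hIb, ← hpo b]
    · refine Finset.sum_congr rfl fun x _ => ?_
      rw [hp]
    · exact (degree_le_of_natDegree_le hbd).trans_lt (by exact_mod_cast hlt)

end Link

/-! ### Chains of determinantal states -/

/-- Orthonormal bases `f t n` of `ℓ²(A t)`, `A t ⊆ {0, …, L}`, together with link coefficients
`c t n`; the dimensions have no interior local minimum in time. -/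
structure LinkedBases (T L N : ℕ) (A : ℕ → Finset ℤ) (f : ℕ → ℕ → ℤ → ℝ) (c : ℕ → ℕ → ℝ) :
    Prop where
  carrier_subset : ∀ t ≤ T, A t ⊆ Finset.Icc 0 (L : ℤ)
  carrier_card : ∀ t ≤ T, N ≤ (A t).card
  support : ∀ t ≤ T, ∀ n, ∀ x ∉ A t, f t n x = 0
  orthonormal : ∀ t ≤ T, ∀ m < (A t).card, ∀ n < (A t).card,
    ∑ x ∈ A t, f t m x * f t n x = if m = n then 1 else 0
  exhausted : ∀ t ≤ T, ∀ n, (A t).card ≤ n → ∀ x, f t n x = 0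
  coeff_ne_zero : ∀ t < T, ∀ n < N, c t n ≠ 0
  card_between : ∀ k t l, k < t → t < l → l ≤ T →
    ∀ n, n < (A k).card → n < (A l).card → n < (A t).card

/-- The sites `0, …, L`. -/
abbrev Site (L : ℕ) : Type := ↥(Finset.Icc (0 : ℤ) (L : ℤ))

/-- The `N`-point configurations in `{0, …, L}`, as increasing sequences. -/
abbrev Config (L N : ℕ) : Type := Fin N ↪o Site L

/-- The set of points of a configuration. -/
def Config.points {L N : ℕ} (x : Config L N) : Finset ℤ :=
  Finset.univ.image fun i => (x i : ℤ)

theorem Config.strictMono_coe {L N : ℕ} (x : Config L N) : StrictMono fun i => (x i : ℤ) :=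
  fun _ _ h => x.strictMono h

theorem strictMono_eq_of_image_eq {N : ℕ} {x y : Fin N → ℤ} (hx : StrictMono x)
    (hy : StrictMono y) (h : Finset.univ.image x = Finset.univ.image y) : x = y := by
  have hr : Set.range (OrderEmbedding.ofStrictMono x hx) =
      Set.range (OrderEmbedding.ofStrictMono y hy) := by
    have := congrArg (fun s : Finset ℤ => (s : Set ℤ)) h
    simpa using this
  exact congrArg (fun e : Fin N ↪o ℤ => (e : Fin N → ℤ)) (OrderEmbedding.range_inj.mp hr)

theorem Config.points_injective {L N : ℕ} :
    Function.Injective (Config.points : Config L N → Finset ℤ) := by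
  intro x y h
  have := strictMono_eq_of_image_eq x.strictMono_coe y.strictMono_coe h
  ext i
  exact congrFun this i

/-- The determinant `det [f_{i}^t (x_j)]`. -/
def stateDet {L N : ℕ} (f : ℕ → ℕ → ℤ → ℝ) (t : ℕ) (x : Config L N) : ℝ :=
  (Matrix.of fun i j : Fin N => f t i (x j)).det

/-- The normalized determinant `det [v_{t,t+1}(x_i, y_j)] / ∏_n c_n^t`. -/
def linkDet {L N : ℕ} (f : ℕ → ℕ → ℤ → ℝ) (c : ℕ → ℕ → ℝ) (t : ℕ) (x y : Config L N) : ℝ :=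
  (Matrix.of fun i j : Fin N => linkSum L f c t (x i) (y j)).det / ∏ n ∈ Finset.range N, c t n

/-- The weight of a trajectory. -/
def chainWeight {T L N : ℕ} (f : ℕ → ℕ → ℤ → ℝ) (c : ℕ → ℕ → ℝ) (x : Fin (T + 1) → Config L N) :
    ℝ :=
  stateDet f 0 (x 0) * (∏ t : Fin T, linkDet f c t (x t.castSucc) (x t.succ)) *
    stateDet f T (x (Fin.last T))

/-- The chain vector of the trajectories weighted by `∏ₜ G t (x t)`. -/
def chainState {L N : ℕ} (f : ℕ → ℕ → ℤ → ℝ) (c : ℕ → ℕ → ℝ) (G : ℕ → Config L N → ℝ) :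
    ℕ → Config L N → ℝ :=
  chainVec (fun x => stateDet f 0 x * G 0 x) fun t x y => linkDet f c t x y * G (t + 1) y

theorem sum_chainWeight_mul_prod {T L N : ℕ} (f : ℕ → ℕ → ℤ → ℝ) (c : ℕ → ℕ → ℝ)
    (G : ℕ → Config L N → ℝ) :
    ∑ x : Fin (T + 1) → Config L N, chainWeight f c x * ∏ t : Fin (T + 1), G t (x t) =
      ∑ y, chainState f c G T y * stateDet f T y := by
  rw [chainState, ← sum_chain]
  refine Finset.sum_congr rfl fun x _ => ?_
  rw [chainWeight, Fin.prod_univ_succ, Finset.prod_mul_distrib]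
  simp only [Fin.val_succ, Fin.val_zero]
  ring

namespace LinkedBases

variable {T L N : ℕ} {A : ℕ → Finset ℤ} {f : ℕ → ℕ → ℤ → ℝ} {c : ℕ → ℕ → ℝ}

theorem sum_site (hB : LinkedBases T L N A f c) {t : ℕ} (ht : t ≤ T) (m n : ℕ) :
    ∑ x : Site L, f t m x * f t n x = if m = n ∧ n < (A t).card then 1 else 0 := by
  by_cases hm : m < (A t).card
  · by_cases hn : n < (A t).card
    · rw [Finset.sum_coe_sort (Finset.Icc (0 : ℤ) L) fun x => f t m x * f t n x,
        ← Finset.sum_subset (hB.carrier_subset t ht), hB.orthonormal t ht m hm n hn]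
      · simp [hn]
      · intro x _ hx
        rw [hB.support t ht m x hx, zero_mul]
    · rw [if_neg (by tauto)]
      exact Finset.sum_eq_zero fun x _ => by
        rw [hB.exhausted t ht n (not_lt.mp hn), mul_zero]
  · rw [if_neg (by rintro ⟨rfl, h⟩; exact hm h)]
    exact Finset.sum_eq_zero fun x _ => by
      rw [hB.exhausted t ht m (not_lt.mp hm), zero_mul]

theorem card_le (hB : LinkedBases T L N A f c) {t : ℕ} (ht : t ≤ T) : (A t).card ≤ L + 1 := by
  have := Finset.card_le_card (hB.carrier_subset t ht)
  rw [Int.card_Icc] at this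
  omega

theorem sum_series_mul (hB : LinkedBases T L N A f c) {t : ℕ} (ht : t ≤ T) (a : ℕ → ℝ) {n : ℕ}
    (hn : n < (A t).card) :
    ∑ x : Site L, (∑ m ∈ Finset.range (L + 1), a m * f t m x) * f t n x = a n := by
  simp only [Finset.sum_mul]
  rw [Finset.sum_comm, Finset.sum_eq_single n]
  · simp only [mul_assoc]
    rw [← Finset.mul_sum, hB.sum_site ht, if_pos ⟨rfl, hn⟩, mul_one]
  · intro m _ hm
    simp only [mul_assoc]
    rw [← Finset.mul_sum, hB.sum_site ht, if_neg (by tauto), mul_zero]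
  · intro h
    rw [Finset.mem_range] at h
    have := hB.card_le ht
    omega

/-- The link operator `v_{k,l}`. -/
def link (L : ℕ) (f : ℕ → ℕ → ℤ → ℝ) (c : ℕ → ℕ → ℝ) (k l : ℕ) : Matrix (Site L) (Site L) ℝ :=
  Matrix.of fun x y =>
    ∑ n ∈ Finset.range (L + 1), (∏ j ∈ Finset.Ico k l, c j n) * f k n x * f l n y

theorem link_succ_apply (t : ℕ) (x y : Site L) :
    link L f c t (t + 1) x y = linkSum L f c t x y := by
  simp [link, linkSum]

theorem sum_link_mul (hB : LinkedBases T L N A f c) {k l : ℕ} (hl : l ≤ T) (x : Site L) {n : ℕ}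
    (hn : n < (A l).card) :
    ∑ y : Site L, link L f c k l x y * f l n y = (∏ j ∈ Finset.Ico k l, c j n) * f k n x :=
  hB.sum_series_mul hl (fun n => (∏ j ∈ Finset.Ico k l, c j n) * f k n x) hn

theorem sum_mul_link (hB : LinkedBases T L N A f c) {k l : ℕ} (hk : k ≤ T) (y : Site L) {n : ℕ}
    (hn : n < (A k).card) :
    ∑ x : Site L, f k n x * link L f c k l x y = (∏ j ∈ Finset.Ico k l, c j n) * f l n y := by
  rw [← hB.sum_series_mul hk (fun n => (∏ j ∈ Finset.Ico k l, c j n) * f l n y) hn]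
  refine Finset.sum_congr rfl fun x _ => ?_
  rw [mul_comm]
  simp only [link, Matrix.of_apply]
  congr 1
  refine Finset.sum_congr rfl fun m _ => ?_
  ring

/-- Orthonormality at the middle time collapses the double sum to one index. -/
theorem link_mul_link (hB : LinkedBases T L N A f c) {k t : ℕ} (hkt : k < t) (ht : t < T) :
    link L f c k t * link L f c t (t + 1) = link L f c k (t + 1) := by
  ext x z
  rw [Matrix.mul_apply]
  have h1 : ∀ y, link L f c k t x y * link L f c t (t + 1) y z =
      ∑ n ∈ Finset.range (L + 1), (∏ j ∈ Finset.Ico k t, c j n) * f k n x *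
        (f t n y * link L f c t (t + 1) y z) := by
    intro y
    conv_lhs => rw [link, Matrix.of_apply, Finset.sum_mul]
    refine Finset.sum_congr rfl fun n _ => ?_
    ring
  rw [Finset.sum_congr rfl fun y _ => h1 y, Finset.sum_comm]
  conv_rhs => rw [link, Matrix.of_apply]
  refine Finset.sum_congr rfl fun n _ => ?_
  rw [← Finset.mul_sum, Finset.prod_Ico_succ_top hkt.le]
  by_cases hn : n < (A t).card
  · rw [hB.sum_mul_link ht.le z hn, Nat.Ico_succ_singleton, Finset.prod_singleton]
    ring
  · have hz : f k n x = 0 ∨ f (t + 1) n z = 0 := by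
      by_contra! h
      have h1 : n < (A k).card := by
        by_contra hk
        exact h.1 (hB.exhausted k (by omega) n (not_lt.mp hk) x)
      have h2 : n < (A (t + 1)).card := by
        by_contra hk
        exact h.2 (hB.exhausted (t + 1) ht n (not_lt.mp hk) z)
      exact hn (hB.card_between k t (t + 1) hkt (Nat.lt_succ_self t) ht n h1 h2)
    have h0 : ∀ y : Site L, f t n y = 0 := fun y => hB.exhausted t ht.le n (not_lt.mp hn) y
    simp only [h0, zero_mul, Finset.sum_const_zero, mul_zero]
    rcases hz with h | h <;> simp [h]

theorem prod_coeff_ne_zero (hB : LinkedBases T L N A f c) {t : ℕ} (ht : t < T) :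
    ∏ n ∈ Finset.range N, c t n ≠ 0 :=
  Finset.prod_ne_zero_iff.mpr fun n hn => hB.coeff_ne_zero t ht n (Finset.mem_range.mp hn)

/-- Cauchy–Binet turns the sum into the determinant of `v_{t,t+1}` applied to the first `N`
functions, that is, of `c_n^t f_n^t(x_i)`; the product of the `c_n^t` cancels the normalization.
With its mirror image `sum_stateDet_mul_linkDet`, this invariance lets past and future be summed
out. -/
theorem sum_linkDet_mul_stateDet (hB : LinkedBases T L N A f c) {t : ℕ} (ht : t < T)
    (x : Config L N) : ∑ y, linkDet f c t x y * stateDet f (t + 1) y = stateDet f t x := by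
  set V : Matrix (Fin N) (Site L) ℝ := Matrix.of fun i y => linkSum L f c t (x i) y with hV
  set F : Matrix (Site L) (Fin N) ℝ := Matrix.of fun y n => f (t + 1) n y with hF
  have h := det_mul_eq_sum_orderEmbedding V F
  have hVF : V * F = Matrix.of fun i n : Fin N => c t n * (Matrix.of fun i n : Fin N =>
      f t n (x i)) i n := by
    ext i n
    have := hB.sum_link_mul (k := t) (Nat.succ_le_of_lt ht) (x i)
      (lt_of_lt_of_le n.2 (hB.carrier_card (t + 1) ht))
    simp only [link_succ_apply, Nat.Ico_succ_singleton, Finset.prod_singleton] at this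
    simpa [Matrix.mul_apply, hV, hF] using this
  rw [hVF, Matrix.det_mul_row, Fin.prod_univ_eq_prod_range (fun n => c t n)] at h
  have hne := hB.prod_coeff_ne_zero ht
  have e : ∀ y : Config L N, linkDet f c t x y * stateDet f (t + 1) y =
      (V.submatrix id y).det * (F.submatrix y id).det / ∏ n ∈ Finset.range N, c t n := by
    intro y
    rw [linkDet, stateDet, ← Matrix.det_transpose (Matrix.of fun i j : Fin N => f (t + 1) i (y j)),
      div_mul_eq_mul_div]
    rfl
  rw [Finset.sum_congr rfl fun y _ => e y, ← Finset.sum_div, ← h, mul_div_cancel_left₀ _ hne,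
    stateDet, ← Matrix.det_transpose]
  rfl

theorem sum_stateDet_mul_linkDet (hB : LinkedBases T L N A f c) {t : ℕ} (ht : t < T)
    (y : Config L N) : ∑ x, stateDet f t x * linkDet f c t x y = stateDet f (t + 1) y := by
  set V : Matrix (Site L) (Fin N) ℝ := Matrix.of fun x i => linkSum L f c t x (y i) with hV
  set F : Matrix (Fin N) (Site L) ℝ := Matrix.of fun n x => f t n x with hF
  have h := det_mul_eq_sum_orderEmbedding F V
  have hVF : F * V = Matrix.of fun n i : Fin N => c t n * (Matrix.of fun n i : Fin N =>
      f (t + 1) n (y i)) n i := by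
    ext n i
    have := hB.sum_mul_link (l := t + 1) ht.le (y i)
      (lt_of_lt_of_le n.2 (hB.carrier_card t ht.le))
    simp only [link_succ_apply, Nat.Ico_succ_singleton, Finset.prod_singleton] at this
    simpa [Matrix.mul_apply, hV, hF] using this
  rw [hVF, Matrix.det_mul_column, Fin.prod_univ_eq_prod_range (fun n => c t n)] at h
  have hne := hB.prod_coeff_ne_zero ht
  have e : ∀ x : Config L N, stateDet f t x * linkDet f c t x y =
      (F.submatrix id x).det * (V.submatrix x id).det / ∏ n ∈ Finset.range N, c t n := by
    intro x
    rw [linkDet, stateDet, mul_div_assoc']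
    rfl
  rw [Finset.sum_congr rfl fun y _ => e y, ← Finset.sum_div, ← h, mul_div_cancel_left₀ _ hne,
    stateDet]

/-- Cauchy–Binet applied to the Gram matrix of the first `N` functions, which is the identity. -/
theorem sum_stateDet_mul_stateDet (hB : LinkedBases T L N A f c) {t : ℕ} (ht : t ≤ T) :
    ∑ x : Config L N, stateDet f t x * stateDet f t x = 1 := by
  set F : Matrix (Fin N) (Site L) ℝ := Matrix.of fun n x => f t n x with hF
  have h := det_mul_eq_sum_orderEmbedding F F.transpose
  have hFF : F * F.transpose = 1 := by
    ext m n
    have := hB.sum_site ht m n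
    rw [Matrix.mul_apply, Matrix.one_apply]
    simp only [hF, Matrix.transpose_apply, Matrix.of_apply, this]
    have hn := lt_of_lt_of_le n.2 (hB.carrier_card t ht)
    simp [Fin.ext_iff, hn]
  rw [hFF, Matrix.det_one] at h
  rw [h]
  refine Finset.sum_congr rfl fun x _ => ?_
  rw [← Matrix.transpose_submatrix, Matrix.det_transpose]
  rfl

theorem chainState_eq_of_one_before (hB : LinkedBases T L N A f c) {G : ℕ → Config L N → ℝ}
    {s : ℕ} (hs : s ≤ T) (hG : ∀ t < s, ∀ x, G t x = 1) (y : Config L N) :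
    chainState f c G s y = stateDet f s y * G s y := by
  induction s generalizing y with
  | zero => rfl
  | succ s ih =>
    change ∑ x, chainState f c G s x * (linkDet f c s x y * G (s + 1) y) = _
    rw [← hB.sum_stateDet_mul_linkDet (Nat.lt_of_succ_le hs) y, Finset.sum_mul]
    refine Finset.sum_congr rfl fun x _ => ?_
    rw [ih (by omega) (fun t ht => hG t (by omega)), hG s (by omega)]
    ring

theorem sum_chainState_mul_stateDet (hB : LinkedBases T L N A f c) {G : ℕ → Config L N → ℝ}
    {s : ℕ} (hs : s ≤ T) (hG : ∀ t, s < t → t ≤ T → ∀ x, G t x = 1) :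
    ∑ y, chainState f c G T y * stateDet f T y = ∑ y, chainState f c G s y * stateDet f s y := by
  suffices h : ∀ d, s + d ≤ T → ∑ y, chainState f c G (s + d) y * stateDet f (s + d) y =
      ∑ y, chainState f c G s y * stateDet f s y by
    have := h (T - s) (by omega)
    rwa [Nat.add_sub_cancel' hs] at this
  intro d
  induction d with
  | zero => simp
  | succ d ih =>
    intro hd
    rw [← ih (by omega)]
    change ∑ y, (∑ x, chainState f c G (s + d) x * (linkDet f c (s + d) x y * G (s + d + 1) y)) *
      stateDet f (s + d + 1) y = _
    simp only [Finset.sum_mul]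
    rw [Finset.sum_comm]
    refine Finset.sum_congr rfl fun x _ => ?_
    rw [← hB.sum_linkDet_mul_stateDet (show s + d < T by omega) x, Finset.mul_sum]
    refine Finset.sum_congr rfl fun y _ => ?_
    rw [hG (s + d + 1) (by omega) (by omega)]
    ring

/-- Nothing is said here about the sign of individual weights; the normalization alone will
determine the constant in the uniform law. -/
theorem sum_chainWeight (hB : LinkedBases T L N A f c) :
    ∑ x : Fin (T + 1) → Config L N, chainWeight f c x = 1 := by
  have h := sum_chainWeight_mul_prod (T := T) (L := L) (N := N) f c fun _ _ => 1
  simp only [Finset.prod_const_one, mul_one] at h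
  rw [h]
  refine Eq.trans ?_ (hB.sum_stateDet_mul_stateDet le_rfl)
  refine Finset.sum_congr rfl fun y _ => ?_
  rw [hB.chainState_eq_of_one_before le_rfl (fun _ _ _ => rfl), mul_one]

end LinkedBases

/-! ### Probabilities of cylinder events -/

/-- The trajectory `t ↦ Y t` of configurations has the law given by `chainWeight`. -/
structure HasChainLaw {Ω : Type*} [MeasurableSpace Ω] {T L N : ℕ} (P : Measure Ω)
    (Y : Fin (T + 1) → Ω → Config L N) (f : ℕ → ℕ → ℤ → ℝ) (c : ℕ → ℕ → ℝ) : Prop where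
  measurable : ∀ B : Set (Fin (T + 1) → Config L N), MeasurableSet {ω | (fun t => Y t ω) ∈ B}
  law : ∀ B : Set (Fin (T + 1) → Config L N),
    P.real {ω | (fun t => Y t ω) ∈ B} = ∑ x, B.indicator (chainWeight f c) x

namespace HasChainLaw

variable {Ω : Type*} [MeasurableSpace Ω] {T L N : ℕ} {P : Measure Ω}
  {Y : Fin (T + 1) → Ω → Config L N} {A : ℕ → Finset ℤ} {f : ℕ → ℕ → ℤ → ℝ} {c : ℕ → ℕ → ℝ}

/-- The unconstrained future is summed out by right invariance, leaving a pairing at time `s`. -/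
theorem real_cylinder (hY : HasChainLaw P Y f c) (hB : LinkedBases T L N A f c)
    (B : ℕ → Set (Config L N)) {s : ℕ} (hs : s ≤ T) (hBs : ∀ t, s < t → t ≤ T → B t = Set.univ) :
    P.real {ω | ∀ t : Fin (T + 1), Y t ω ∈ B t} =
      ∑ y, chainState f c (fun t => (B t).indicator 1) s y * stateDet f s y := by
  rw [← hB.sum_chainState_mul_stateDet hs, ← sum_chainWeight_mul_prod]
  · refine (hY.law {x | ∀ t : Fin (T + 1), x t ∈ B t}).trans (Finset.sum_congr rfl fun x _ => ?_)
    classical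
    rw [Set.indicator_apply]
    split_ifs with h
    · rw [Finset.prod_eq_one, mul_one]
      intro t _
      rw [Set.indicator_of_mem (h t), Pi.one_apply]
    · obtain ⟨t, ht⟩ : ∃ t : Fin (T + 1), x t ∉ B t := by simpa using h
      rw [Finset.prod_eq_zero (Finset.mem_univ t) (Set.indicator_of_notMem ht _), mul_zero]
  · intro t h1 h2 x
    rw [hBs t h1 h2]
    simp

theorem real_past (hY : HasChainLaw P Y f c) (hB : LinkedBases T L N A f c)
    (a : ℕ → Config L N) {s : ℕ} (hs : s ≤ T) :
    P.real {ω | ∀ t : Fin (T + 1), (t : ℕ) ≤ s → Y t ω = a t} =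
      stateDet f 0 (a 0) * (∏ j ∈ Finset.range s, linkDet f c j (a j) (a (j + 1))) *
        stateDet f s (a s) := by
  classical
  set B : ℕ → Set (Config L N) := fun t => {x | t ≤ s → x = a t} with hBdef
  have hind : ∀ t ≤ s, ∀ x, (B t).indicator (1 : Config L N → ℝ) x = if x = a t then 1 else 0 := by
    intro t ht x
    simp [Set.indicator_apply, hBdef, ht]
  -- With the past fixed pointwise, the chain vector is concentrated at `a t` and each step
  -- multiplies it by one link factor.
  have hchain : ∀ t ≤ s, ∀ y, chainState f c (fun t => (B t).indicator 1) t y =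
      if y = a t then
        stateDet f 0 (a 0) * ∏ j ∈ Finset.range t, linkDet f c j (a j) (a (j + 1)) else 0 := by
    intro t
    induction t with
    | zero =>
      intro ht y
      change stateDet f 0 y * (B 0).indicator 1 y = _
      rw [hind 0 ht]
      split_ifs with h
      · simp [h]
      · simp
    | succ t ih =>
      intro ht y
      change ∑ x, chainState f c (fun t => (B t).indicator 1) t x *
        (linkDet f c t x y * (B (t + 1)).indicator 1 y) = _
      rw [Finset.sum_eq_single (a t)]
      · rw [ih (by omega), if_pos rfl, hind (t + 1) ht]
        split_ifs with h
        · rw [Finset.prod_range_succ, h]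
          ring
        · ring
      · intro x _ hx
        rw [ih (by omega), if_neg hx, zero_mul]
      · simp
  have h := hY.real_cylinder hB B hs fun t h1 _ => by
    ext x
    simp [hBdef, not_le.mpr h1]
  refine h.trans ?_
  rw [Finset.sum_eq_single (a s)]
  · rw [hchain s le_rfl, if_pos rfl]
  · intro y _ hy
    rw [hchain s le_rfl, if_neg hy, zero_mul]
  · simp

theorem real_state (hY : HasChainLaw P Y f c) (hB : LinkedBases T L N A f c)
    (t : Fin (T + 1)) (x : Config L N) :
    P.real {ω | Y t ω = x} = stateDet f t x ^ 2 := by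
  classical
  have h := hY.real_cylinder hB (fun s => {y | s = t → y = x}) (Nat.lt_succ_iff.mp t.2)
    fun s h1 _ => by
      ext y
      simp [h1.ne']
  have hset : {ω | ∀ s : Fin (T + 1), Y s ω ∈ {y : Config L N | (s : ℕ) = t → y = x}} =
      {ω | Y t ω = x} := by
    ext ω
    simp only [Set.mem_ofPred_eq]
    constructor
    · intro h
      exact h t rfl
    · intro h s hs
      rw [Fin.ext hs, h]
  rw [hset] at h
  rw [h, Finset.sum_eq_single x]
  · rw [hB.chainState_eq_of_one_before (Nat.lt_succ_iff.mp t.2)]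
    · simp [sq]
    · intro s hs y
      simp [hs.ne]
  · intro y _ hy
    rw [hB.chainState_eq_of_one_before (Nat.lt_succ_iff.mp t.2)]
    · simp [hy]
    · intro s hs y
      simp [hs.ne]
  · simp

theorem real_two_states (hY : HasChainLaw P Y f c) (hB : LinkedBases T L N A f c)
    (t : Fin T) (x y : Config L N) :
    P.real ({ω | Y t.castSucc ω = x} ∩ {ω | Y t.succ ω = y}) =
      stateDet f t x * linkDet f c t x y * stateDet f (t + 1) y := by
  classical
  set B : ℕ → Set (Config L N) := fun s => {z | (s = t → z = x) ∧ (s = t + 1 → z = y)} with hBd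
  have h := hY.real_cylinder hB B (Nat.succ_le_of_lt t.2) fun s h1 _ => by
      ext z
      have h2 : s ≠ t := by omega
      have h3 : s ≠ t + 1 := by omega
      simp [B, h2, h3]
  have hset : {ω | ∀ s : Fin (T + 1), Y s ω ∈ B s} =
      {ω | Y t.castSucc ω = x} ∩ {ω | Y t.succ ω = y} := by
    ext ω
    simp only [hBd, Set.mem_ofPred_eq, Set.mem_inter_iff]
    constructor
    · intro h
      exact ⟨(h t.castSucc).1 rfl, (h t.succ).2 rfl⟩
    · rintro ⟨h1, h2⟩ s
      refine ⟨fun hs => ?_, fun hs => ?_⟩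
      · rw [show s = t.castSucc from Fin.ext hs, h1]
      · rw [show s = t.succ from Fin.ext hs, h2]
  rw [hset] at h
  have hpast : ∀ z, chainState f c (fun s => (B s).indicator 1) t z =
      stateDet f t z * if z = x then 1 else 0 := by
    intro z
    rw [hB.chainState_eq_of_one_before t.2.le]
    · simp [Set.indicator_apply, hBd]
    · intro s hs z
      have : s ≠ t + 1 := by omega
      simp [hBd, hs.ne, this]
  have hstep : ∀ z, chainState f c (fun s => (B s).indicator 1) (t + 1) z =
      stateDet f t x * linkDet f c t x y * if z = y then 1 else 0 := by
    intro z
    change ∑ w, chainState f c (fun s => (B s).indicator 1) t w *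
      (linkDet f c t w z * (B (t + 1)).indicator 1 z) = _
    rw [Finset.sum_eq_single x]
    · rw [hpast, if_pos rfl]
      by_cases hz : z = y
      · simp [hBd, hz]
      · simp [hBd, hz]
    · intro w _ hw
      rw [hpast, if_neg hw]
      ring
    · simp
  rw [h, Finset.sum_eq_single y]
  · rw [hstep, if_pos rfl, mul_one]
  · intro z _ hz
    rw [hstep, if_neg hz]
    ring
  · simp

end HasChainLaw

/-- At most one factor differs from one, so there are no cross terms. -/
theorem prod_one_add_ite_of_subsingleton {R ι : Type*} [CommRing R] (I : Finset ι) (p : ι → Prop)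
    [DecidablePred p] (hp : ∀ i ∈ I, ∀ j ∈ I, p i → p j → i = j) (s : R) :
    ∏ i ∈ I, (1 + if p i then s else 0) = 1 + ∑ i ∈ I, if p i then s else 0 := by
  by_cases h : ∃ i ∈ I, p i
  · obtain ⟨i, hi, hpi⟩ := h
    rw [Finset.prod_eq_single i, Finset.sum_eq_single i]
    · intro j hj hji
      rw [if_neg fun hpj => hji (hp j hj i hi hpj hpi)]
    · exact fun h => absurd hi h
    · intro j hj hji
      rw [if_neg fun hpj => hji (hp j hj i hi hpj hpi), add_zero]
    · exact fun h => absurd hi h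
  · push Not at h
    rw [Finset.prod_eq_one, Finset.sum_eq_zero, add_zero]
    · exact fun i hi => if_neg (h i hi)
    · intro i hi
      rw [if_neg (h i hi), add_zero]

/-! ### Correlation functions and the extended kernel -/

namespace LinkedBases

variable {T L N : ℕ} {A : ℕ → Finset ℤ} {f : ℕ → ℕ → ℤ → ℝ} {c : ℕ → ℕ → ℝ}

/-- The functions `f t n · ∏_{j<t} c j n`. -/
def forwardMatrix (L N : ℕ) (f : ℕ → ℕ → ℤ → ℝ) (c : ℕ → ℕ → ℝ) (t : ℕ) :
    Matrix (Fin N) (Site L) ℝ :=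
  Matrix.of fun n x => (∏ j ∈ Finset.range t, c j n) * f t n x

/-- The functions `f t n / ∏_{j<t} c j n`. -/
def backwardMatrix (L N : ℕ) (f : ℕ → ℕ → ℤ → ℝ) (c : ℕ → ℕ → ℝ) (t : ℕ) :
    Matrix (Fin N) (Site L) ℝ :=
  Matrix.of fun n x => (∏ j ∈ Finset.range t, c j n)⁻¹ * f t n x

/-- The forward matrix transported by multiplication by `g` and the links. -/
def transported (L N : ℕ) (f : ℕ → ℕ → ℤ → ℝ) (c : ℕ → ℕ → ℝ) (g : ℕ → Site L → ℝ) :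
    ℕ → Matrix (Fin N) (Site L) ℝ
  | 0 => forwardMatrix L N f c 0
  | t + 1 => transported L N f c g t * Matrix.diagonal (g t) * link L f c t (t + 1)

/-- A multiplicative functional acts on each particle separately, so the state stays an `N × N`
minor of one-particle row vectors; each link is one application of Cauchy–Binet. The denominators
collect the normalizations in `linkDet`. -/
theorem chainState_eq_det (g : ℕ → Site L → ℝ) (t : ℕ) (x : Config L N) :
    chainState f c (fun t x => ∏ i, g t (x i)) t x =
      ((transported L N f c g t * Matrix.diagonal (g t)).submatrix id x).det /
        ∏ j ∈ Finset.range t, ∏ n ∈ Finset.range N, c j n := by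
  have hdet : ∀ (M : Matrix (Fin N) (Site L) ℝ) (t : ℕ) (x : Config L N),
      ((M * Matrix.diagonal (g t)).submatrix id x).det =
        (M.submatrix id x).det * ∏ i, g t (x i) := by
    intro M t x
    have : (M * Matrix.diagonal (g t)).submatrix id x =
        Matrix.of fun i j => g t (x j) * (M.submatrix id x) i j := by
      ext i j
      simp [Matrix.mul_diagonal, mul_comm]
    rw [this, Matrix.det_mul_row, mul_comm]
  induction t generalizing x with
  | zero =>
    change stateDet f 0 x * _ = _
    rw [hdet, Finset.range_zero, Finset.prod_empty, div_one]
    congr 1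
    rw [stateDet]
    congr 1
    ext i j
    simp [transported, forwardMatrix]
  | succ t ih =>
    change ∑ z, chainState f c (fun t x => ∏ i, g t (x i)) t z *
      (linkDet f c t z x * ∏ i, g (t + 1) (x i)) = _
    have hcb := det_mul_eq_sum_orderEmbedding (transported L N f c g t * Matrix.diagonal (g t))
      ((link L f c t (t + 1)).submatrix id x)
    have hsub : (transported L N f c g (t + 1)).submatrix id x =
        (transported L N f c g t * Matrix.diagonal (g t)) *
          (link L f c t (t + 1)).submatrix id x := by
      ext i j
      simp only [transported, Matrix.submatrix_apply, Matrix.mul_apply, id]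
    rw [hdet, hsub, hcb, Finset.prod_range_succ, Finset.sum_mul, Finset.sum_div]
    refine Finset.sum_congr rfl fun z _ => ?_
    rw [ih, linkDet]
    have : ((link L f c t (t + 1)).submatrix id x).submatrix z id =
        Matrix.of fun i j : Fin N => linkSum L f c t (z i) (x j) := by
      ext i j
      simp [link_succ_apply]
    rw [this]
    ring

theorem sum_chainState_mul_stateDet_eq_det (g : ℕ → Site L → ℝ) :
    ∑ x : Config L N, chainState f c (fun t x => ∏ i, g t (x i)) T x * stateDet f T x =
      (transported L N f c g T * Matrix.diagonal (g T) *
        (backwardMatrix L N f c T).transpose).det := by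
  rw [det_mul_eq_sum_orderEmbedding]
  refine Finset.sum_congr rfl fun x _ => ?_
  rw [chainState_eq_det, ← Matrix.transpose_submatrix, Matrix.det_transpose]
  have : (backwardMatrix L N f c T).submatrix id x =
      Matrix.of fun i j : Fin N => (∏ k ∈ Finset.range T, c k i)⁻¹ *
        (Matrix.of fun i j : Fin N => f T i (x j)) i j := by
    ext i j
    rfl
  rw [this, Matrix.det_mul_column, stateDet, Finset.prod_inv_distrib,
    Fin.prod_univ_eq_prod_range (fun n => ∏ k ∈ Finset.range T, c k n), Finset.prod_comm]
  ring

theorem prod_coeff_range_ne_zero (hB : LinkedBases T L N A f c) {t n : ℕ} (ht : t ≤ T)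
    (hn : n < N) : ∏ j ∈ Finset.range t, c j n ≠ 0 :=
  Finset.prod_ne_zero_iff.mpr fun _ hj =>
    hB.coeff_ne_zero _ (lt_of_lt_of_le (Finset.mem_range.mp hj) ht) n hn

/-- For `k < l`, minus the sum over `i ≥ N` is the sum over `i < N` minus the full link. This brings
both branches into the form `Φᵀ Ψ - v` of `det_one_add_smul_extended`. -/
theorem extendedKernel_eq (hB : LinkedBases T L N A f c) {k l : ℕ} (hk : k ≤ T) (hl : l ≤ T)
    (x y : Site L) :
    extendedKernel L N f c x k y l =
      (∑ n, backwardMatrix L N f c k n x * forwardMatrix L N f c l n y) -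
        if k < l then link L f c k l x y else 0 := by
  have hNL : N ≤ L + 1 := (hB.carrier_card T le_rfl).trans (hB.card_le le_rfl)
  have hsum : (∑ n, backwardMatrix L N f c k n x * forwardMatrix L N f c l n y) =
      ∑ n ∈ Finset.range N, (∏ j ∈ Finset.range k, c j n)⁻¹ * (∏ j ∈ Finset.range l, c j n) *
        f k n x * f l n y := by
    rw [← Fin.sum_univ_eq_sum_range (fun n => (∏ j ∈ Finset.range k, c j n)⁻¹ *
      (∏ j ∈ Finset.range l, c j n) * f k n x * f l n y)]
    refine Finset.sum_congr rfl fun n _ => ?_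
    simp only [backwardMatrix, forwardMatrix, Matrix.of_apply]
    ring
  rw [extendedKernel, hsum]
  by_cases h : l ≤ k
  · rw [if_pos h, if_neg (not_lt.mpr h), sub_zero]
    refine Finset.sum_congr rfl fun n hn => ?_
    have h1 := hB.prod_coeff_range_ne_zero hk (Finset.mem_range.mp hn)
    have h2 := hB.prod_coeff_range_ne_zero hl (Finset.mem_range.mp hn)
    rw [← Finset.prod_range_mul_prod_Ico (fun j => c j n) h] at h1 ⊢
    have h3 := (mul_ne_zero_iff.mp h1).2
    field_simp
  · rw [if_neg h, if_pos (not_le.mp h)]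
    have hle := (not_le.mp h).le
    have h1 : ∑ n ∈ Finset.range N, (∏ j ∈ Finset.range k, c j n)⁻¹ *
        (∏ j ∈ Finset.range l, c j n) * f k n x * f l n y =
        ∑ n ∈ Finset.range N, (∏ j ∈ Finset.Ico k l, c j n) * f k n x * f l n y := by
      refine Finset.sum_congr rfl fun n hn => ?_
      have h1 := hB.prod_coeff_range_ne_zero hk (Finset.mem_range.mp hn)
      rw [← Finset.prod_range_mul_prod_Ico (fun j => c j n) hle]
      field_simp
    rw [h1, link, Matrix.of_apply, ← Finset.sum_range_add_sum_Ico _ hNL]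
    ring

/-- The generating function over marked points is regrouped by time and particle. Since the marked
points are distinct, a particle meets at most one of them at each time, so the product becomes the
one-particle functional `1 + u`. -/
theorem det_one_add_smul_extendedKernel (hB : LinkedBases T L N A f c) {ι : Type*} [Fintype ι]
    [DecidableEq ι] (τ : ι → ℕ) (hτ : ∀ i, τ i ≤ T) (ξ : ι → Site L)
    (hinj : Function.Injective fun i => (ξ i, τ i)) (s : ℝ) :
    (1 + s • Matrix.of fun i j : ι => extendedKernel L N f c (ξ i) (τ i) (ξ j) (τ j)).det =
      ∑ x : Fin (T + 1) → Config L N, chainWeight f c x *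
        ∏ i, (1 + if ∃ a, x ⟨τ i, Nat.lt_succ_of_le (hτ i)⟩ a = ξ i then s else 0) := by
  set u : ℕ → Site L → ℝ := fun t e => ∑ i, if τ i = t ∧ ξ i = e then s else 0 with hu
  have hprod : ∀ x : Fin (T + 1) → Config L N,
      ∏ i, (1 + if ∃ a, x ⟨τ i, Nat.lt_succ_of_le (hτ i)⟩ a = ξ i then s else 0) =
        ∏ t : Fin (T + 1), ∏ a, (1 + u t (x t a)) := by
    intro x
    have h1 : ∀ (t : Fin (T + 1)) (a : Fin N), 1 + u t (x t a) =
        ∏ i, (1 + if τ i = t ∧ ξ i = x t a then s else 0) := by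
      intro t a
      rw [prod_one_add_ite_of_subsingleton]
      rintro i - j - ⟨hi, hi'⟩ ⟨hj, hj'⟩
      exact hinj (Prod.ext (hi'.trans hj'.symm) (hi.trans hj.symm))
    have h2 : ∏ t : Fin (T + 1), ∏ a, (1 + u t (x t a)) =
        ∏ i, ∏ t : Fin (T + 1), ∏ a : Fin N,
          (1 + if τ i = t ∧ ξ i = x t a then s else 0) := by
      simp only [h1]
      rw [Finset.prod_comm]
      rw [Finset.prod_congr rfl fun a _ => Finset.prod_comm, Finset.prod_comm]
      exact Finset.prod_congr rfl fun i _ => Finset.prod_comm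
    rw [h2]
    refine Finset.prod_congr rfl fun i _ => ?_
    rw [Finset.prod_eq_single ⟨τ i, Nat.lt_succ_of_le (hτ i)⟩]
    · simp only [true_and]
      rw [prod_one_add_ite_of_subsingleton]
      · congr 1
        split_ifs with h
        · obtain ⟨a, ha⟩ := h
          rw [Finset.sum_eq_single a]
          · rw [if_pos ha.symm]
          · intro b _ hb
            rw [if_neg]
            intro hb'
            exact hb ((x _).injective (hb'.symm.trans ha.symm))
          · simp
        · symm
          refine Finset.sum_eq_zero fun a _ => if_neg fun ha => h ⟨a, ha.symm⟩
      · intro a _ b _ ha hb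
        exact (x _).injective (ha.symm.trans hb)
    · intro t _ ht
      refine Finset.prod_eq_one fun a _ => ?_
      rw [if_neg, add_zero]
      rintro ⟨h, -⟩
      exact ht (Fin.ext h.symm)
    · simp
  have hN : ∀ {t : ℕ}, t ≤ T → ∀ n : Fin N, (n : ℕ) < (A t).card := fun ht n =>
    lt_of_lt_of_le n.2 (hB.carrier_card _ ht)
  rw [Finset.sum_congr rfl fun x _ => by rw [hprod x],
    sum_chainWeight_mul_prod f c fun t x => ∏ a, (1 + u t (x a)),
    sum_chainState_mul_stateDet_eq_det fun t e => 1 + u t e,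
    ← det_one_add_smul_extended (forwardMatrix L N f c) (backwardMatrix L N f c) (link L f c)
      ?_ ?_ ?_ ?_ s τ hτ ξ u (fun _ _ => rfl) (transported L N f c fun t e => 1 + u t e) rfl
      (fun _ _ => rfl)]
  · congr 3
    ext i j
    rw [Matrix.of_apply, Matrix.of_apply, hB.extendedKernel_eq (hτ i) (hτ j)]
  · intro t ht
    ext n y
    simp only [Matrix.mul_apply, forwardMatrix, Matrix.of_apply, mul_assoc]
    rw [← Finset.mul_sum, hB.sum_mul_link ht.le y (hN ht.le n), Nat.Ico_succ_singleton,
      Finset.prod_singleton, Finset.prod_range_succ]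
    ring
  · intro k t hkt ht
    exact hB.link_mul_link hkt ht
  · intro k hk
    ext n x
    simp only [Matrix.mul_apply, backwardMatrix, Matrix.of_apply, Matrix.transpose_apply,
      mul_assoc]
    rw [← Finset.mul_sum, Finset.sum_congr rfl fun y _ => mul_comm _ _,
      hB.sum_link_mul le_rfl x (hN le_rfl n),
      ← Finset.prod_range_mul_prod_Ico (fun j => c j n) hk.le]
    have h1 := hB.prod_coeff_range_ne_zero le_rfl n.2
    rw [← Finset.prod_range_mul_prod_Ico (fun j => c j n) hk.le] at h1
    obtain ⟨h2, h3⟩ := mul_ne_zero_iff.mp h1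
    field_simp
  · ext m n
    simp only [Matrix.mul_apply, forwardMatrix, backwardMatrix, Matrix.of_apply,
      Matrix.transpose_apply, Matrix.one_apply]
    have h1 := hB.prod_coeff_range_ne_zero le_rfl n.2
    have h2 := hB.sum_site le_rfl m n
    have e : ∀ x : Site L, (∏ j ∈ Finset.range T, c j m) * f T m x *
        ((∏ j ∈ Finset.range T, c j n)⁻¹ * f T n x) =
        (∏ j ∈ Finset.range T, c j m) * (∏ j ∈ Finset.range T, c j n)⁻¹ *
          (f T m x * f T n x) := fun x => by ring
    rw [Finset.sum_congr rfl fun x _ => e x, ← Finset.mul_sum, h2]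
    by_cases hmn : m = n
    · subst hmn
      rw [if_pos ⟨rfl, hN le_rfl m⟩, if_pos rfl, mul_one, mul_inv_cancel₀ h1]
    · rw [if_neg fun h => hmn (Fin.ext h.1), if_neg hmn, mul_zero]

/-- With `s = 1/r` and multiplication by `r` to the number of marked points, the generating identity
becomes continuous in `r`; its value at `r = 0` isolates the event that all points are occupied. -/
theorem det_extendedKernel (hB : LinkedBases T L N A f c) {ι : Type*} [Fintype ι]
    [DecidableEq ι] (τ : ι → ℕ) (hτ : ∀ i, τ i ≤ T) (ξ : ι → Site L)
    (hinj : Function.Injective fun i => (ξ i, τ i)) :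
    (Matrix.of fun i j : ι => extendedKernel L N f c (ξ i) (τ i) (ξ j) (τ j)).det =
      ∑ x : Fin (T + 1) → Config L N, chainWeight f c x *
        ∏ i, if ∃ a, x ⟨τ i, Nat.lt_succ_of_le (hτ i)⟩ a = ξ i then 1 else 0 := by
  set K := Matrix.of fun i j : ι => extendedKernel L N f c (ξ i) (τ i) (ξ j) (τ j) with hK
  have heq : (fun r : ℝ => (r • (1 : Matrix ι ι ℝ) + K).det) = fun r : ℝ =>
      ∑ x : Fin (T + 1) → Config L N, chainWeight f c x *
        ∏ i, (r + if ∃ a, x ⟨τ i, Nat.lt_succ_of_le (hτ i)⟩ a = ξ i then 1 else 0) := by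
    refine Continuous.ext_on (dense_compl_singleton (0 : ℝ)) ?_ ?_ ?_
    · fun_prop
    · fun_prop
    · intro r hr
      have hr : r ≠ 0 := hr
      have h := hB.det_one_add_smul_extendedKernel τ hτ ξ hinj r⁻¹
      have e : r • (1 : Matrix ι ι ℝ) + K = r • (1 + r⁻¹ • K) := by
        rw [smul_add, smul_inv_smul₀ hr]
      simp only [e]
      rw [Matrix.det_smul, h, Finset.mul_sum]
      refine Finset.sum_congr rfl fun x _ => ?_
      rw [mul_left_comm, ← Finset.card_univ, ← Finset.prod_const, ← Finset.prod_mul_distrib]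
      congr 1
      refine Finset.prod_congr rfl fun i _ => ?_
      split_ifs
      · field_simp
      · simp
  have h0 := congrFun heq 0
  simpa using h0

end LinkedBases

theorem HasChainLaw.real_forall_mem {Ω : Type*} [MeasurableSpace Ω] {T L N : ℕ} {P : Measure Ω}
    {Y : Fin (T + 1) → Ω → Config L N} {A : ℕ → Finset ℤ} {f : ℕ → ℕ → ℤ → ℝ} {c : ℕ → ℕ → ℝ}
    (hY : HasChainLaw P Y f c) (hB : LinkedBases T L N A f c) {ι : Type*} [Fintype ι]
    [DecidableEq ι] (τ : ι → Fin (T + 1)) (ξ : ι → Site L)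
    (hinj : Function.Injective fun i => (ξ i, τ i)) :
    P.real {ω | ∀ i, ∃ a, Y (τ i) ω a = ξ i} =
      (Matrix.of fun i j : ι => extendedKernel L N f c (ξ i) (τ i) (ξ j) (τ j)).det := by
  classical
  rw [hB.det_extendedKernel (fun i => (τ i : ℕ)) (fun i => Nat.lt_succ_iff.mp (τ i).2) ξ]
  · refine (hY.law {x | ∀ i, ∃ a, x (τ i) a = ξ i}).trans (Finset.sum_congr rfl fun x _ => ?_)
    rw [Set.indicator_apply]
    split_ifs with h
    · rw [Finset.prod_eq_one, mul_one]
      exact fun i _ => if_pos (h i)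
    · obtain ⟨i, hi⟩ : ∃ i, ¬∃ a, x (τ i) a = ξ i := not_forall.mp h
      rw [Finset.prod_eq_zero (Finset.mem_univ i) (if_neg hi), mul_zero]
  · intro i j hij
    simp only [Prod.mk.injEq] at hij
    exact hinj (Prod.ext hij.1 (Fin.ext hij.2))

/-! ### The link kernel of the Hahn system -/

section StepKernel

/-- The gauge that relates the link kernel to the indicator of unit steps. -/
def pathGauge (N T S t : ℕ) (x : ℤ) : ℝ :=
  Real.sqrt (hahnWeight N T S t x) *
    ((Nat.factorial ((T : ℤ) - t - S + x).toNat : ℝ) *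
      (Nat.factorial ((S : ℤ) + N - 1 - x).toNat : ℝ))

/-- The indicator of unit steps after the gauge transformation. -/
def stepKernel (N T S t : ℕ) (x y : ℤ) : ℝ :=
  if y = x ∨ y = x + 1 then
    pathGauge N T S t x / (pathGauge N T S (t + 1) y *
      Real.sqrt (((t : ℝ) + N) * ((T : ℝ) + N - t - 1)))
  else 0

theorem pathGauge_ne_zero {N T S t : ℕ} {x : ℤ} (hx : x ∈ hahnSupport N T S t) :
    pathGauge N T S t x ≠ 0 := by
  have := Real.sqrt_pos.mpr (hahnWeight_pos hx)
  rw [pathGauge]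
  positivity

theorem stepKernel_ne_zero {N T S t : ℕ} {x y : ℤ} (h : stepKernel N T S t x y ≠ 0) :
    y = x ∨ y = x + 1 := by
  by_contra h'
  exact h (if_neg h')

/-- The gauge is chosen for this cancellation: one factorial loses its top factor, which is the
coefficient of `ψ(x)` in the difference operator. In `pathGauge_div_move` the other factorial does
the same for `ψ(x+1)`. -/
theorem pathGauge_div_stay {N T S t : ℕ} {x : ℤ} (h2 : x ∈ hahnSupport N T S (t + 1)) :
    pathGauge N T S t x / pathGauge N T S (t + 1) x *
        Real.sqrt (hahnWeight N T S (t + 1) x) =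
      Real.sqrt (hahnWeight N T S t x) * ((T : ℝ) - t - S + x) := by
  have hw := Real.sqrt_pos.mpr (hahnWeight_pos h2)
  rw [pathGauge, pathGauge]
  rw [hahnSupport, Finset.mem_Icc] at h2
  obtain ⟨b, hb⟩ : ∃ b : ℕ, (T : ℤ) - (t + 1 : ℕ) - S + x = b :=
    ⟨_, (Int.toNat_of_nonneg (by omega)).symm⟩
  rw [show (T : ℤ) - t - S + x = (b + 1 : ℕ) by omega, hb]
  have hb' : (T : ℝ) - t - S + x = (b + 1 : ℕ) := by
    have : (T : ℤ) - t - S + x = (b + 1 : ℕ) := by omega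
    exact_mod_cast this
  rw [hb']
  simp only [Int.toNat_natCast, Nat.factorial_succ]
  push_cast
  field_simp

theorem pathGauge_div_move {N T S t : ℕ} {x : ℤ} (h2 : x + 1 ∈ hahnSupport N T S (t + 1)) :
    pathGauge N T S t x / pathGauge N T S (t + 1) (x + 1) *
        Real.sqrt (hahnWeight N T S (t + 1) (x + 1)) =
      Real.sqrt (hahnWeight N T S t x) * ((S : ℝ) + N - 1 - x) := by
  have hw := Real.sqrt_pos.mpr (hahnWeight_pos h2)
  rw [pathGauge, pathGauge]
  rw [hahnSupport, Finset.mem_Icc] at h2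
  obtain ⟨a, ha⟩ : ∃ a : ℕ, (S : ℤ) + N - 1 - (x + 1) = a :=
    ⟨_, (Int.toNat_of_nonneg (by omega)).symm⟩
  rw [show (T : ℤ) - (t + 1 : ℕ) - S + (x + 1) = (T : ℤ) - t - S + x by omega, ha,
    show (S : ℤ) + N - 1 - x = (a + 1 : ℕ) by omega]
  have ha' : (S : ℝ) + N - 1 - x = (a + 1 : ℕ) := by
    have : (S : ℤ) + N - 1 - x = (a + 1 : ℕ) := by omega
    exact_mod_cast this
  rw [ha']
  simp only [Int.toNat_natCast, Nat.factorial_succ]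
  push_cast
  field_simp

/-- On functions `h √w`, the gauged step indicator acts as the difference operator on `h`. If a
neighbour leaves the next support, its coefficient is zero. -/
theorem sum_stepKernel_mul {N T S t : ℕ} {x : ℤ} (hx : x ∈ hahnSupport N T S t) (h : ℤ → ℝ) :
    ∑ y ∈ hahnSupport N T S (t + 1),
        stepKernel N T S t x y * (h y * Real.sqrt (hahnWeight N T S (t + 1) y)) =
      Real.sqrt (hahnWeight N T S t x) *
        (((T : ℝ) - t - S + x) * h x + ((S : ℝ) + N - 1 - x) * h (x + 1)) /
        Real.sqrt (((t : ℝ) + N) * ((T : ℝ) + N - t - 1)) := by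
  set k := Real.sqrt (((t : ℝ) + N) * ((T : ℝ) + N - t - 1)) with hk
  have e : ∀ y, stepKernel N T S t x y * (h y * Real.sqrt (hahnWeight N T S (t + 1) y)) =
      (if y = x then pathGauge N T S t x / pathGauge N T S (t + 1) x *
        Real.sqrt (hahnWeight N T S (t + 1) x) * h x / k else 0) +
      (if y = x + 1 then pathGauge N T S t x / pathGauge N T S (t + 1) (x + 1) *
        Real.sqrt (hahnWeight N T S (t + 1) (x + 1)) * h (x + 1) / k else 0) := by
    intro y
    rw [stepKernel]
    by_cases h1 : y = x
    · subst h1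
      simp [← hk]
      ring
    · by_cases h2 : y = x + 1
      · subst h2
        simp [← hk]
        ring
      · simp [h1, h2]
  rw [Finset.sum_congr rfl fun y _ => e y, Finset.sum_add_distrib, Finset.sum_ite_eq',
    Finset.sum_ite_eq', mul_add, add_div]
  congr 1
  · split_ifs with h2
    · rw [pathGauge_div_stay h2]
      ring
    · have : (T : ℤ) - t - S + x = 0 := by
        rw [hahnSupport, Finset.mem_Icc] at hx h2
        omega
      have : (T : ℝ) - t - S + x = 0 := by exact_mod_cast this
      rw [this]
      ring
  · split_ifs with h2
    · rw [pathGauge_div_move h2]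
      ring
    · have : (S : ℤ) + N - 1 - x = 0 := by
        rw [hahnSupport, Finset.mem_Icc] at hx h2
        omega
      have : (S : ℝ) + N - 1 - x = 0 := by exact_mod_cast this
      rw [this]
      ring

theorem hahnC_eq {N T t n : ℕ} (hN : 1 ≤ N) (ht : t < T) :
    hahnC N T t n = Real.sqrt (((t : ℝ) + N - n) * ((T : ℝ) + N - t - 1 - n)) /
      Real.sqrt (((t : ℝ) + N) * ((T : ℝ) + N - t - 1)) := by
  have h1 : (0 : ℝ) < (t : ℝ) + N := by
    have : 0 < t + N := by omega
    exact_mod_cast this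
  have h2 : (0 : ℝ) < (T : ℝ) + N - t - 1 := by
    have : (0 : ℤ) < (T : ℤ) + N - t - 1 := by omega
    exact_mod_cast this
  rw [hahnC, ← Real.sqrt_div' _ (mul_pos h1 h2).le]
  congr 1
  field_simp

theorem hahnC_ne_zero {N T t n : ℕ} (hn : n < N) (ht : t < T) : hahnC N T t n ≠ 0 := by
  have h1 : (0 : ℝ) < (t : ℝ) + N - n := by
    have : (0 : ℤ) < (t : ℤ) + N - n := by omega
    exact_mod_cast this
  have h2 : (0 : ℝ) < (T : ℝ) + N - t - 1 - n := by
    have : (0 : ℤ) < (T : ℤ) + N - t - 1 - n := by omega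
    exact_mod_cast this
  have h3 : (0 : ℝ) < (t : ℝ) + N := by linarith [Nat.cast_nonneg (α := ℝ) n]
  have h4 : (0 : ℝ) < (T : ℝ) + N - t - 1 := by linarith [Nat.cast_nonneg (α := ℝ) n]
  rw [hahnC_eq (by omega) ht]
  positivity

theorem sum_sum_hahnF_mul_stepKernel_mul_hahnF {N T S t m n : ℕ} (hN : 1 ≤ N) (hS : S ≤ T)
    (ht : t < T) (hm : (m : ℤ) ≤ hahnM N T S t) (hn : (n : ℤ) ≤ hahnM N T S (t + 1)) :
    ∑ x ∈ hahnSupport N T S t, ∑ y ∈ hahnSupport N T S (t + 1),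
        hahnF N T S t m x * (stepKernel N T S t x y * hahnF N T S (t + 1) n y) =
      if m = n then hahnC N T t n else 0 := by
  have hn1 := Real.sqrt_pos.mpr (hahnNormSq_pos hN hS ht.le hm)
  have hn2 := Real.sqrt_pos.mpr (hahnNormSq_pos hN hS ht hn)
  set k := Real.sqrt (((t : ℝ) + N) * ((T : ℝ) + N - t - 1)) with hk
  have e : ∀ x ∈ hahnSupport N T S t, ∑ y ∈ hahnSupport N T S (t + 1),
        hahnF N T S t m x * (stepKernel N T S t x y * hahnF N T S (t + 1) n y) =
      hahnWeight N T S t x * hahnH N T S t m x *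
        (((T : ℝ) - t - S + x) * hahnH N T S (t + 1) n x +
          ((S : ℝ) + N - 1 - x) * hahnH N T S (t + 1) n (x + 1)) /
        (k * Real.sqrt (hahnNormSq N T S t m) * Real.sqrt (hahnNormSq N T S (t + 1) n)) := by
    intro x hx
    have e1 : ∀ y, stepKernel N T S t x y * hahnF N T S (t + 1) n y =
        stepKernel N T S t x y *
          (hahnH N T S (t + 1) n y * Real.sqrt (hahnWeight N T S (t + 1) y)) /
          Real.sqrt (hahnNormSq N T S (t + 1) n) := by
      intro y
      rw [hahnF_eq hn]
      ring
    rw [← Finset.mul_sum, Finset.sum_congr rfl fun y _ => e1 y, ← Finset.sum_div,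
      sum_stepKernel_mul hx, hahnF_eq hm, ← hk]
    nth_rewrite 3 [← Real.mul_self_sqrt (hahnWeight_nonneg N T S t x)]
    field_simp
  rw [Finset.sum_congr rfl e, ← Finset.sum_div, sum_hahnH_step_hahnH hN hS ht hm hn]
  split_ifs with h
  · rw [hahnC_eq hN ht, ← hk]
    field_simp
  · rw [zero_div]

/-- The step kernel is expanded in the complete orthonormal systems at both times; its matrix is
diagonal with entries `hahnC`. -/
theorem linkSum_hahnF_eq_stepKernel {N T S t : ℕ} (hN : 1 ≤ N) (hS : S ≤ T) (ht : t < T) (x y : ℤ) :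
    linkSum (S + N - 1) (hahnF N T S) (hahnC N T) t x y = stepKernel N T S t x y := by
  by_cases hx : x ∈ hahnSupport N T S t
  swap
  · have : pathGauge N T S t x = 0 := by rw [pathGauge, hahnWeight, if_neg hx]; simp
    rw [linkSum, stepKernel, this]
    simp [hahnF_eq_zero_of_notMem hx]
  by_cases hy : y ∈ hahnSupport N T S (t + 1)
  swap
  -- Here the gauge is a denominator; division by zero is zero, which is the required value.
  · have : pathGauge N T S (t + 1) y = 0 := by rw [pathGauge, hahnWeight, if_neg hy]; simp
    rw [linkSum, stepKernel, this]
    simp [hahnF_eq_zero_of_notMem hy]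
  set R := Finset.range (S + N - 1 + 1) with hR
  have h1 : stepKernel N T S t x y = ∑ x' ∈ hahnSupport N T S t, ∑ y' ∈ hahnSupport N T S (t + 1),
      (∑ m ∈ R, hahnF N T S t m x * hahnF N T S t m x') * stepKernel N T S t x' y' *
        ∑ n ∈ R, hahnF N T S (t + 1) n y * hahnF N T S (t + 1) n y' := by
    rw [Finset.sum_eq_single x, Finset.sum_eq_single y]
    · rw [sum_hahnF_mul_hahnF_eq_delta hN hS ht.le hx hx,
        sum_hahnF_mul_hahnF_eq_delta hN hS ht hy hy]
      simp
    · intro y' hy' hne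
      rw [sum_hahnF_mul_hahnF_eq_delta hN hS ht hy hy', if_neg hne.symm, mul_zero]
    · exact fun h => absurd hy h
    · intro x' hx' hne
      refine Finset.sum_eq_zero fun y' _ => ?_
      rw [sum_hahnF_mul_hahnF_eq_delta hN hS ht.le hx hx', if_neg hne.symm, zero_mul, zero_mul]
    · exact fun h => absurd hx h
  have h2 : stepKernel N T S t x y = ∑ m ∈ R, ∑ n ∈ R,
      hahnF N T S t m x * hahnF N T S (t + 1) n y *
        ∑ x' ∈ hahnSupport N T S t, ∑ y' ∈ hahnSupport N T S (t + 1),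
          hahnF N T S t m x' * (stepKernel N T S t x' y' * hahnF N T S (t + 1) n y') := by
    rw [h1]
    have e : ∀ x' y', (∑ m ∈ R, hahnF N T S t m x * hahnF N T S t m x') * stepKernel N T S t x' y' *
        ∑ n ∈ R, hahnF N T S (t + 1) n y * hahnF N T S (t + 1) n y' =
        ∑ m ∈ R, ∑ n ∈ R, hahnF N T S t m x * hahnF N T S (t + 1) n y *
          (hahnF N T S t m x' * (stepKernel N T S t x' y' * hahnF N T S (t + 1) n y')) := by
      intro x' y'
      rw [Finset.sum_mul, Finset.sum_mul_sum]
      refine Finset.sum_congr rfl fun m _ => Finset.sum_congr rfl fun n _ => ?_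
      ring
    simp only [e]
    rw [Finset.sum_congr rfl fun x' _ => Finset.sum_comm, Finset.sum_comm]
    refine Finset.sum_congr rfl fun m _ => ?_
    rw [Finset.sum_congr rfl fun x' _ => Finset.sum_comm, Finset.sum_comm]
    refine Finset.sum_congr rfl fun n _ => ?_
    simp only [Finset.mul_sum]
  rw [h2, linkSum]
  refine Finset.sum_congr rfl fun m hm => ?_
  rw [Finset.sum_eq_single m]
  · by_cases hm1 : (m : ℤ) ≤ hahnM N T S t
    · by_cases hm2 : (m : ℤ) ≤ hahnM N T S (t + 1)
      · rw [sum_sum_hahnF_mul_stepKernel_mul_hahnF hN hS ht hm1 hm2, if_pos rfl]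
        ring
      · rw [hahnF_eq_zero_of_lt (t := t + 1) (not_le.mp hm2)]
        ring
    · rw [hahnF_eq_zero_of_lt (t := t) (not_le.mp hm1)]
      ring
  · intro n _ hne
    by_cases hm1 : (m : ℤ) ≤ hahnM N T S t
    · by_cases hn2 : (n : ℤ) ≤ hahnM N T S (t + 1)
      · rw [sum_sum_hahnF_mul_stepKernel_mul_hahnF hN hS ht hm1 hn2, if_neg hne.symm, mul_zero]
      · rw [hahnF_eq_zero_of_lt (t := t + 1) (not_le.mp hn2)]
        ring
    · rw [hahnF_eq_zero_of_lt (t := t) (not_le.mp hm1)]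
      ring
  · exact fun h => absurd hm h

theorem linkedBases_hahnF {N T S : ℕ} (hN : 1 ≤ N) (hS : S ≤ T) :
    LinkedBases T (S + N - 1) N (hahnSupport N T S) (hahnF N T S) (hahnC N T) where
  carrier_subset t ht x hx := by
    rw [hahnSupport, Finset.mem_Icc] at hx
    rw [Finset.mem_Icc]
    omega
  carrier_card t ht := by
    have := card_hahnSupport hN hS ht
    rw [hahnM_eq] at this
    omega
  support t ht n x hx := hahnF_eq_zero_of_notMem hx
  orthonormal t ht m hm n hn := by
    have := card_hahnSupport hN hS ht
    exact sum_hahnF_mul_hahnF hN hS ht (by omega) (by omega)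
  exhausted t ht n hn x := by
    have := card_hahnSupport hN hS ht
    exact hahnF_eq_zero_of_lt (by omega) x
  coeff_ne_zero t ht n hn := hahnC_ne_zero hn ht
  -- By `hahnM_eq` the dimension is a minimum minus a maximum of affine functions of time, hence
  -- concave, so it is at least the smaller of its values at `k` and `l`.
  card_between k t l hkt htl hl n hk hl' := by
    have h1 := card_hahnSupport hN hS (show k ≤ T by omega)
    have h2 := card_hahnSupport hN hS (show t ≤ T by omega)
    have h3 := card_hahnSupport hN hS hl
    rw [hahnM_eq] at h1 h2 h3
    omega

end StepKernel

/-! ### Path families as trajectories of configurations -/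

namespace PathFamily

variable {N T S : ℕ}

/-- Adjacent heights change by `0` or `1`, so paths cannot exchange order without meeting. -/
theorem strictMono_pos (ω : PathFamily N T S) (t : Fin (T + 1)) :
    StrictMono fun i => ω.pos i t := by
  induction t using Fin.induction with
  | zero =>
    intro i j hij
    simp only [ω.start]
    exact_mod_cast hij
  | succ t ih =>
    intro i j hij
    have h1 := ih hij
    have h2 := ω.step i t
    have h3 := ω.step j t
    have h4 : ω.pos i t.succ ≠ ω.pos j t.succ := fun h => hij.ne (ω.disjoint t.succ h)
    simp only at h1 ⊢
    omega

theorem pos_bounds_start (ω : PathFamily N T S) (i : Fin N) (t : Fin (T + 1)) :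
    (i : ℤ) ≤ ω.pos i t ∧ ω.pos i t ≤ i + t := by
  induction t using Fin.induction with
  | zero => simp [ω.start]
  | succ t ih =>
    have := ω.step i t
    rw [Fin.val_succ]
    rw [Fin.val_castSucc] at ih
    push_cast
    omega

theorem pos_bounds_finish (ω : PathFamily N T S) (i : Fin N) (t : Fin (T + 1)) :
    (S : ℤ) + i - (T - t) ≤ ω.pos i t ∧ ω.pos i t ≤ S + i := by
  induction t using Fin.reverseInduction with
  | last => simp [ω.finish]
  | cast t ih =>
    have := ω.step i t
    rw [Fin.val_succ] at ih
    rw [Fin.val_castSucc]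
    push_cast at ih
    omega

theorem pos_mem_hahnSupport (ω : PathFamily N T S) (i : Fin N) (t : Fin (T + 1)) :
    ω.pos i t ∈ hahnSupport N T S t := by
  have h1 := ω.pos_bounds_start i t
  have h2 := ω.pos_bounds_finish i t
  have := i.2
  rw [hahnSupport, Finset.mem_Icc]
  omega

theorem pos_mem_Icc (ω : PathFamily N T S) (i : Fin N) (t : Fin (T + 1)) :
    ω.pos i t ∈ Finset.Icc (0 : ℤ) ((S + N - 1 : ℕ) : ℤ) := by
  have h1 := ω.pos_bounds_start i t
  have h2 := ω.pos_bounds_finish i t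
  have := i.2
  rw [Finset.mem_Icc]
  omega

/-- The configuration occupied at time `t`. -/
def config (t : Fin (T + 1)) (ω : PathFamily N T S) : Config (S + N - 1) N :=
  OrderEmbedding.ofStrictMono (fun i => ⟨ω.pos i t, ω.pos_mem_Icc i t⟩) (ω.strictMono_pos t)

theorem coe_config (t : Fin (T + 1)) (ω : PathFamily N T S) (i : Fin N) :
    (config t ω i : ℤ) = ω.pos i t := rfl

theorem points_config (t : Fin (T + 1)) (ω : PathFamily N T S) :
    (config t ω).points = pathProcess N T S t ω := rfl

theorem config_injective :
    Function.Injective fun (ω : PathFamily N T S) (t : Fin (T + 1)) => config t ω := by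
  intro ω ω' h
  have hpos : ω.pos = ω'.pos := by
    funext i t
    rw [← coe_config, ← coe_config, show config t ω = config t ω' from congrFun h t]
  cases ω
  cases ω'
  simpa using hpos

instance : Finite (PathFamily N T S) := Finite.of_injective _ config_injective

/-- The family of paths that move up first and then stay. -/
def moveFirst (N : ℕ) (hS : S ≤ T) : PathFamily N T S where
  pos i t := i + min (t : ℤ) S
  start i := by simp
  finish i := by
    rw [Fin.val_last]
    omega
  step i t := by
    rw [Fin.val_succ, Fin.val_castSucc]
    push_cast
    omega
  disjoint t i j h := by
    simp only [add_left_inj, Nat.cast_inj] at h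
    exact Fin.ext h

end PathFamily

theorem prod_div_succ {T : ℕ} (a : Fin (T + 1) → ℝ) (ha : ∀ t, a t ≠ 0) :
    ∏ t : Fin T, a t.castSucc / a t.succ = a 0 / a (Fin.last T) := by
  induction T with
  | zero => simp [div_self (ha 0)]
  | succ T ih =>
    rw [Fin.prod_univ_castSucc]
    have h := ih (fun t => a t.castSucc) fun t => ha _
    simp only [Fin.succ_castSucc, Fin.castSucc_zero] at h ⊢
    rw [h, Fin.succ_last]
    have := ha (Fin.last T).castSucc
    field_simp

/-- The sequence has to exhaust the interval. At times `0` and `T` the support has exactly `N`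
points, so this forces the end points of the paths. -/
theorem eq_add_of_strictMono_of_mem_Icc {N : ℕ} {x : Fin N → ℤ} (hx : StrictMono x) {a : ℤ}
    (h : ∀ i, x i ∈ Finset.Icc a (a + N - 1)) (i : Fin N) : x i = a + i := by
  have hy : StrictMono fun i : Fin N => a + (i : ℤ) := by
    intro i j hij
    simpa using hij
  have key : ∀ y : Fin N → ℤ, StrictMono y → (∀ i, y i ∈ Finset.Icc a (a + N - 1)) →
      Finset.univ.image y = Finset.Icc a (a + N - 1) := by
    intro y hy hmem
    refine Finset.eq_of_subset_of_card_le (fun z hz => ?_) ?_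
    · obtain ⟨i, -, rfl⟩ := Finset.mem_image.mp hz
      exact hmem i
    · rw [Finset.card_image_of_injective _ hy.injective, Int.card_Icc, Finset.card_univ,
        Fintype.card_fin]
      omega
  refine congrFun (strictMono_eq_of_image_eq hx hy ((key x hx h).trans (key _ hy ?_).symm)) i
  intro j
  have := j.2
  rw [Finset.mem_Icc]
  omega

/-! ### The uniform law on path families as a chain law -/

section PathLaw

variable {N T S : ℕ}

theorem linkDet_hahnF_eq (hN : 1 ≤ N) (hS : S ≤ T) (t : Fin T) (x y : Config (S + N - 1) N) :
    linkDet (hahnF N T S) (hahnC N T) t x y =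
      (∏ i, stepKernel N T S t (x i) (y i)) / ∏ n ∈ Finset.range N, hahnC N T t n := by
  rw [linkDet]
  congr 1
  simp only [linkSum_hahnF_eq_stepKernel hN hS t.2]
  exact det_eq_prod_of_unit_steps _ (fun _ _ => stepKernel_ne_zero) x.strictMono_coe
    y.strictMono_coe

theorem mem_hahnSupport_of_stateDet_ne_zero {t : ℕ} {x : Config (S + N - 1) N}
    (h : stateDet (hahnF N T S) t x ≠ 0) (i : Fin N) : (x i : ℤ) ∈ hahnSupport N T S t := by
  by_contra hi
  refine h (Matrix.det_eq_zero_of_column_eq_zero i fun j => ?_)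
  exact hahnF_eq_zero_of_notMem hi

/-- The state determinants confine both ends to supports of size `N`, nonzero links force unit
steps, and a configuration has distinct points. -/
theorem exists_path_of_chainWeight_ne_zero (hN : 1 ≤ N) (hS : S ≤ T)
    {x : Fin (T + 1) → Config (S + N - 1) N}
    (h : chainWeight (hahnF N T S) (hahnC N T) x ≠ 0) :
    ∃ ω : PathFamily N T S, (fun t => PathFamily.config t ω) = x := by
  rw [chainWeight] at h
  obtain ⟨h', hT⟩ := mul_ne_zero_iff.mp h
  obtain ⟨h0, hlink⟩ := mul_ne_zero_iff.mp h'
  refine ⟨⟨fun i t => x t i, fun i => ?_, fun i => ?_, fun i t => ?_, fun t => ?_⟩, ?_⟩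
  · rw [eq_add_of_strictMono_of_mem_Icc (x 0).strictMono_coe (a := 0), zero_add]
    intro j
    have := mem_hahnSupport_of_stateDet_ne_zero h0 j
    rw [hahnSupport, Finset.mem_Icc] at this
    rw [Finset.mem_Icc]
    omega
  · rw [eq_add_of_strictMono_of_mem_Icc (x (Fin.last T)).strictMono_coe (a := S)]
    intro j
    have := mem_hahnSupport_of_stateDet_ne_zero hT j
    rw [hahnSupport, Finset.mem_Icc] at this
    rw [Finset.mem_Icc]
    omega
  · have := Finset.prod_ne_zero_iff.mp hlink t (Finset.mem_univ t)
    rw [linkDet_hahnF_eq hN hS] at this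
    exact stepKernel_ne_zero
      (Finset.prod_ne_zero_iff.mp (div_ne_zero_iff.mp this).1 i (Finset.mem_univ i))
  · exact (x t).strictMono_coe.injective
  · funext t
    ext i
    rfl

/-- The gauge quotients telescope along each path, leaving only the fixed end points and factors
depending on time alone. -/
theorem chainWeight_config (hN : 1 ≤ N) (hS : S ≤ T) (ω ω' : PathFamily N T S) :
    chainWeight (hahnF N T S) (hahnC N T) (fun t => PathFamily.config t ω) =
      chainWeight (hahnF N T S) (hahnC N T) fun t => PathFamily.config t ω' := by
  have h0 : PathFamily.config 0 ω = PathFamily.config 0 ω' := by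
    ext i
    rw [PathFamily.coe_config, PathFamily.coe_config, ω.start, ω'.start]
  have hT : PathFamily.config (Fin.last T) ω = PathFamily.config (Fin.last T) ω' := by
    ext i
    rw [PathFamily.coe_config, PathFamily.coe_config, ω.finish, ω'.finish]
  have key : ∀ ω : PathFamily N T S, ∏ t : Fin T, linkDet (hahnF N T S) (hahnC N T) t
      (PathFamily.config t.castSucc ω) (PathFamily.config t.succ ω) =
      (∏ i : Fin N, pathGauge N T S 0 i / pathGauge N T S T (S + i)) /
        (∏ t : Fin T, Real.sqrt (((t : ℝ) + N) * ((T : ℝ) + N - t - 1)) ^ N) /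
        ∏ t : Fin T, ∏ n ∈ Finset.range N, hahnC N T t n := by
    intro ω
    have hstep : ∀ t : Fin T, linkDet (hahnF N T S) (hahnC N T) t
        (PathFamily.config t.castSucc ω) (PathFamily.config t.succ ω) =
        (∏ i : Fin N, pathGauge N T S t.castSucc (ω.pos i t.castSucc) /
          pathGauge N T S t.succ (ω.pos i t.succ)) /
          Real.sqrt (((t : ℝ) + N) * ((T : ℝ) + N - t - 1)) ^ N /
          ∏ n ∈ Finset.range N, hahnC N T t n := by
      intro t
      rw [linkDet_hahnF_eq hN hS]
      congr 1
      have hN' : Real.sqrt (((t : ℝ) + N) * ((T : ℝ) + N - t - 1)) ^ N =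
          ∏ _i : Fin N, Real.sqrt (((t : ℝ) + N) * ((T : ℝ) + N - t - 1)) := by simp
      rw [hN', ← Finset.prod_div_distrib]
      refine Finset.prod_congr rfl fun i _ => ?_
      rw [PathFamily.coe_config, PathFamily.coe_config, stepKernel, if_pos (ω.step i t), div_div]
      rfl
    rw [Finset.prod_congr rfl fun t _ => hstep t, Finset.prod_div_distrib,
      Finset.prod_div_distrib, Finset.prod_comm]
    congr 2
    refine Finset.prod_congr rfl fun i _ => ?_
    rw [prod_div_succ (fun t : Fin (T + 1) => pathGauge N T S t (ω.pos i t)) fun t =>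
      pathGauge_ne_zero (ω.pos_mem_hahnSupport i t), ω.start, ω.finish]
    rfl
  rw [chainWeight, chainWeight, key, key, h0, hT]

theorem hasChainLaw_pathMeasure (hN : 1 ≤ N) (hS : S ≤ T) :
    HasChainLaw (pathMeasure N T S) PathFamily.config (hahnF N T S) (hahnC N T) where
  measurable _ := trivial
  law B := by
    classical
    have := Fintype.ofFinite (PathFamily N T S)
    have hsum : ∀ B : Set (Fin (T + 1) → Config (S + N - 1) N),
        ∑ x, B.indicator (chainWeight (hahnF N T S) (hahnC N T)) x =
          ∑ ω : PathFamily N T S, if (fun t => PathFamily.config t ω) ∈ B then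
            chainWeight (hahnF N T S) (hahnC N T) (fun t => PathFamily.config t ω) else 0 := by
      intro B
      symm
      refine Finset.sum_of_injOn (fun ω t => PathFamily.config t ω)
        (fun _ _ _ _ h => PathFamily.config_injective h) (by simp) ?_ ?_
      · intro x _ hx
        rw [Set.indicator_apply_eq_zero]
        intro _
        by_contra h
        obtain ⟨ω, hω⟩ := exists_path_of_chainWeight_ne_zero hN hS h
        exact hx ⟨ω, by simp, hω⟩
      · intro ω _
        rw [Set.indicator_apply]
    -- Any family would serve as reference. The value `κ` is never computed: total mass one gives
    -- `card * κ = 1`.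
    set κ := chainWeight (hahnF N T S) (hahnC N T)
      fun t => PathFamily.config t (PathFamily.moveFirst N hS) with hκ
    have hconst : ∀ ω : PathFamily N T S,
        chainWeight (hahnF N T S) (hahnC N T) (fun t => PathFamily.config t ω) = κ :=
      fun ω => chainWeight_config hN hS ω _
    simp only [hconst] at hsum
    have htotal := (linkedBases_hahnF hN hS).sum_chainWeight
    have huniv := hsum Set.univ
    simp only [Set.indicator_univ, Set.mem_univ, if_true, Finset.sum_const, Finset.card_univ,
      nsmul_eq_mul] at huniv
    rw [htotal] at huniv
    rw [hsum B, ← Finset.sum_filter, Finset.sum_const, nsmul_eq_mul, pathMeasure,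
      Measure.real, ProbabilityTheory.uniformOn_univ]
    have hcount : Measure.count {ω : PathFamily N T S | (fun t => PathFamily.config t ω) ∈ B} =
        ((Finset.univ.filter fun ω : PathFamily N T S =>
          (fun t => PathFamily.config t ω) ∈ B).card : ENNReal) := by
      rw [← Measure.count_apply_finset' (s := Finset.univ.filter fun ω : PathFamily N T S =>
          (fun t => PathFamily.config t ω) ∈ B) trivial]
      simp
    rw [hcount, ENNReal.toReal_div, ENNReal.toReal_natCast, ENNReal.toReal_natCast]
    have hne : (Fintype.card (PathFamily N T S) : ℝ) ≠ 0 := fun h => by simp [h] at huniv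
    rw [div_eq_iff hne, mul_assoc, mul_comm κ, ← huniv, mul_one]

theorem isProbabilityMeasure_pathMeasure (hS : S ≤ T) :
    IsProbabilityMeasure (pathMeasure N T S) :=
  haveI : MeasurableSingletonClass (PathFamily N T S) := ⟨fun _ => trivial⟩
  ProbabilityTheory.isProbabilityMeasure_uniformOn Set.finite_univ
    ⟨PathFamily.moveFirst N hS, trivial⟩

end PathLaw

/-! ### Processes of configurations -/

/-- An increasing sequence in `{0, …, L}` as a configuration. -/
def Config.ofStrictMono {L N : ℕ} (x : Fin N → ℤ) (hx : StrictMono x)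
    (hmem : ∀ i, x i ∈ Finset.Icc 0 (L : ℤ)) : Config L N :=
  OrderEmbedding.ofStrictMono (fun i => ⟨x i, hmem i⟩) hx

theorem Config.points_ofStrictMono {L N : ℕ} (x : Fin N → ℤ) (hx : StrictMono x)
    (hmem : ∀ i, x i ∈ Finset.Icc 0 (L : ℤ)) :
    (Config.ofStrictMono x hx hmem).points = Finset.univ.image x := rfl

theorem Config.mem_points {L N : ℕ} {x : Config L N} {z : ℤ} :
    z ∈ x.points ↔ ∃ i, (x i : ℤ) = z := by
  simp [Config.points]

theorem Config.points_subset {L N : ℕ} (x : Config L N) : x.points ⊆ Finset.Icc 0 (L : ℤ) := by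
  intro z hz
  obtain ⟨i, rfl⟩ := Config.mem_points.mp hz
  exact (x i).2

theorem Config.card_points {L N : ℕ} (x : Config L N) : x.points.card = N := by
  rw [Config.points, Finset.card_image_of_injective _ x.strictMono_coe.injective,
    Finset.card_univ, Fintype.card_fin]

theorem real_cond_apply {Ω : Type*} [MeasurableSpace Ω] (P : Measure Ω) {s : Set Ω}
    (hs : MeasurableSet s) (t : Set Ω) :
    (ProbabilityTheory.cond P s).real t = P.real (s ∩ t) / P.real s := by
  rw [Measure.real, ProbabilityTheory.cond_apply hs, ENNReal.toReal_mul, ENNReal.toReal_inv,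
    mul_comm, div_eq_mul_inv]
  rfl

section Configurations

variable {Ω : Type*} [MeasurableSpace Ω] {T L N : ℕ} {P : Measure Ω}
  {X : Fin (T + 1) → Ω → Finset ℤ} {Y : Fin (T + 1) → Ω → Config L N} {A : ℕ → Finset ℤ}
  {f : ℕ → ℕ → ℤ → ℝ} {c : ℕ → ℕ → ℝ}

/-- Extending a past by one step multiplies its probability by `linkDet · stateDet (t+1) / stateDet
t`, which involves only the last two states. -/
theorem HasChainLaw.isMarkovProcess [IsProbabilityMeasure P] (hY : HasChainLaw P Y f c) (hB : LinkedBases T L N A f c)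
    (hX : ∀ t ω, X t ω = (Y t ω).points) : IsMarkovProcess P X := by
  intro t a hpos
  obtain ⟨ω₀, hω₀⟩ := nonempty_of_measure_ne_zero hpos
  have hω₀ : ∀ s ≤ t.castSucc, X s ω₀ = a s := hω₀
  have hms : MeasurableSet {ω | ∀ s ≤ t.castSucc, X s ω = a s} := by
    have : {ω | ∀ s ≤ t.castSucc, X s ω = a s} =
        {ω | (fun s => Y s ω) ∈ {x : Fin (T + 1) → Config L N |
          ∀ s ≤ t.castSucc, (x s).points = a s}} := by
      simp only [hX]
      rfl
    rw [this]
    exact hY.measurable _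
  have hmt : MeasurableSet {ω | X t.castSucc ω = a t.castSucc} := by
    have : {ω | X t.castSucc ω = a t.castSucc} =
        {ω | (fun s => Y s ω) ∈ {x : Fin (T + 1) → Config L N |
          (x t.castSucc).points = a t.castSucc}} := by
      simp only [hX]
      rfl
    rw [this]
    exact hY.measurable _
  rw [real_cond_apply P hms, real_cond_apply P hmt]
  -- A target set that is no `N`-point configuration is never reached, so both sides are zero.
  by_cases hz : ∃ z : Config L N, z.points = a t.succ
  swap
  · have : {ω | X t.succ ω = a t.succ} = ∅ := by
      ext ω
      simp only [Set.mem_ofPred_eq, Set.mem_empty_iff_false, iff_false, hX]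
      exact fun h => hz ⟨_, h⟩
    rw [this]
    simp
  obtain ⟨z, hz⟩ := hz
  -- The prescribed past has positive probability, so a sample point `ω₀` realizes it by genuine
  -- configurations.
  set b : ℕ → Config L N := fun s =>
    if h : s ≤ t then Y ⟨s, by omega⟩ ω₀ else z with hb
  have hbt : ∀ s : Fin (T + 1), s ≤ t.castSucc → (b s).points = a s := by
    intro s hs
    have hs' : (s : ℕ) ≤ t := hs
    simp only [hb, hs', dif_pos, Fin.eta]
    rw [← hX, hω₀ s hs]
  have hbs : b (t + 1) = z := dif_neg (by omega)
  have hXY : ∀ s : Fin (T + 1), s ≤ t.castSucc → ∀ ω, X s ω = a s ↔ Y s ω = b s := by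
    intro s hs ω
    rw [hX, ← hbt s hs, Config.points_injective.eq_iff]
  have hXY' : ∀ ω, X t.succ ω = a t.succ ↔ Y t.succ ω = z := by
    intro ω
    rw [hX, ← hz, Config.points_injective.eq_iff]
  have e1 : {ω | ∀ s ≤ t.castSucc, X s ω = a s} =
      {ω | ∀ s : Fin (T + 1), (s : ℕ) ≤ t → Y s ω = b s} := by
    ext ω
    exact forall_congr' fun s => forall_congr' fun hs => hXY s hs ω
  have e2 : {ω | ∀ s ≤ t.castSucc, X s ω = a s} ∩ {ω | X t.succ ω = a t.succ} =
      {ω | ∀ s : Fin (T + 1), (s : ℕ) ≤ t + 1 → Y s ω = b s} := by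
    ext ω
    rw [e1]
    simp only [Set.mem_inter_iff, Set.mem_ofPred_eq, hXY']
    constructor
    · rintro ⟨h1, h2⟩ s hs
      rcases hs.eq_or_lt with h | h
      · rw [show s = t.succ from Fin.ext h, h2, Fin.val_succ, hbs]
      · exact h1 s (by omega)
    · intro h
      refine ⟨fun s hs => h s (by omega), ?_⟩
      rw [h t.succ le_rfl, Fin.val_succ, hbs]
  have e3 : {ω | X t.castSucc ω = a t.castSucc} = {ω | Y t.castSucc ω = b t} := by
    ext ω
    exact hXY t.castSucc le_rfl ω
  have e4 : {ω | X t.succ ω = a t.succ} = {ω | Y t.succ ω = z} := by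
    ext ω
    exact hXY' ω
  have hpos' : P.real {ω | ∀ s ≤ t.castSucc, X s ω = a s} ≠ 0 := by
    rw [Measure.real, ENNReal.toReal_ne_zero]
    exact ⟨hpos, measure_ne_top _ _⟩
  rw [e2, e3, e4, hY.real_two_states hB, hY.real_state hB t.castSucc,
    hY.real_past hB b (Nat.succ_le_of_lt t.2)]
  rw [e1, hY.real_past hB b t.2.le] at hpos' ⊢
  rw [Finset.prod_range_succ, hbs, Fin.val_castSucc]
  obtain ⟨h1, h2⟩ := mul_ne_zero_iff.mp hpos'
  obtain ⟨h3, h4⟩ := mul_ne_zero_iff.mp h1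
  field_simp

theorem HasChainLaw.meetsEynardMehta [IsProbabilityMeasure P] (hY : HasChainLaw P Y f c) (hB : LinkedBases T L N A f c)
    (hX : ∀ t ω, X t ω = (Y t ω).points) : MeetsEynardMehta P X L N A f c where
  isProbabilityMeasure := inferInstance
  measurable t B := by
    simp only [hX]
    exact hY.measurable {x | (x t).points = B}
  state_subset t ω := hX t ω ▸ (Y t ω).points_subset
  state_card t ω := hX t ω ▸ (Y t ω).card_points
  carrier_subset := hB.carrier_subset
  carrier_card := hB.carrier_card
  support := hB.support
  orthonormal := hB.orthonormal
  exhausted := hB.exhausted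
  coeff_ne_zero := hB.coeff_ne_zero
  markov := hY.isMarkovProcess hB hX
  distribution t x hx hmem := by
    have : {ω | X t ω = Finset.univ.image x} = {ω | Y t ω = Config.ofStrictMono x hx hmem} := by
      ext ω
      rw [Set.mem_ofPred_eq, Set.mem_ofPred_eq, hX, ← Config.points_ofStrictMono x hx hmem,
        Config.points_injective.eq_iff]
    rw [this, hY.real_state hB]
    rfl
  transition t x y hx hy hxm hym hpos := by
    have hx' : {ω | X t.castSucc ω = Finset.univ.image x} =
        {ω | Y t.castSucc ω = Config.ofStrictMono x hx hxm} := by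
      ext ω
      rw [Set.mem_ofPred_eq, Set.mem_ofPred_eq, hX, ← Config.points_ofStrictMono x hx hxm,
        Config.points_injective.eq_iff]
    have hy' : {ω | X t.succ ω = Finset.univ.image y} =
        {ω | Y t.succ ω = Config.ofStrictMono y hy hym} := by
      ext ω
      rw [Set.mem_ofPred_eq, Set.mem_ofPred_eq, hX, ← Config.points_ofStrictMono y hy hym,
        Config.points_injective.eq_iff]
    rw [hx'] at hpos ⊢
    have hms : MeasurableSet {ω | Y t.castSucc ω = Config.ofStrictMono x hx hxm} :=
      hY.measurable {z | z t.castSucc = Config.ofStrictMono x hx hxm}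
    rw [hy', real_cond_apply P hms,
      hY.real_two_states hB, hY.real_state hB t.castSucc]
    -- A state of positive probability has nonzero determinant, since its probability is the square.
    have hne : stateDet f t (Config.ofStrictMono x hx hxm) ≠ 0 := by
      intro h
      have := hY.real_state hB t.castSucc (Config.ofStrictMono x hx hxm)
      rw [Fin.val_castSucc, h, Measure.real, sq, mul_zero, ENNReal.toReal_eq_zero_iff] at this
      exact this.elim hpos (measure_ne_top _ _)
    have hc := hB.prod_coeff_ne_zero t.2
    rw [Fin.val_castSucc, linkDet]
    change _ = _ * stateDet f (t + 1) (Config.ofStrictMono y hy hym) /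
      (stateDet f t (Config.ofStrictMono x hx hxm) * _)
    rw [sq, mul_assoc, mul_div_mul_left _ _ hne, div_mul_eq_mul_div, div_div, mul_comm (∏ n ∈ _, _)]
    rfl

theorem HasChainLaw.isDeterminantalWithKernel (hY : HasChainLaw P Y f c)
    (hB : LinkedBases T L N A f c) (hX : ∀ t ω, X t ω = (Y t ω).points) :
    IsDeterminantalWithKernel P X (extendedKernel L N f c) := by
  intro n x t hinj
  by_cases hmem : ∀ i, x i ∈ Finset.Icc 0 (L : ℤ)
  · have hev : {ω | ∀ i, x i ∈ X (t i) ω} =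
        {ω | ∀ i, ∃ a, Y (t i) ω a = (⟨x i, hmem i⟩ : Site L)} := by
      ext ω
      simp only [Set.mem_ofPred_eq, hX, Config.mem_points, Subtype.ext_iff]
    rw [hev, hY.real_forall_mem hB t (fun i => ⟨x i, hmem i⟩)]
    intro i j hij
    simp only [Prod.mk.injEq, Subtype.mk.injEq] at hij
    exact hinj (Prod.ext hij.1 hij.2)
  -- A point outside `{0, …, L}` is never occupied, and its row of the kernel vanishes.
  · obtain ⟨i, hi⟩ := not_forall.mp hmem
    have hev : {ω | ∀ i, x i ∈ X (t i) ω} = ∅ := by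
      ext ω
      simp only [Set.mem_ofPred_eq, Set.mem_empty_iff_false, iff_false, hX]
      exact fun h => hi ((Y (t i) ω).points_subset (h i))
    have hz : ∀ m, f (t i) m (x i) = 0 := fun m =>
      hB.support _ (Nat.lt_succ_iff.mp (t i).2) m _ fun h =>
        hi (hB.carrier_subset _ (Nat.lt_succ_iff.mp (t i).2) h)
    rw [hev, measureReal_empty, Matrix.det_eq_zero_of_row_eq_zero i]
    intro j
    rw [Matrix.of_apply, extendedKernel]
    simp [hz]

end Configurations

end HahnPaths

end

theorem proposition5 (N T S : ℕ) (hN : 1 ≤ N) (hST : S ≤ T) :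
    HahnPaths.MeetsEynardMehta (HahnPaths.pathMeasure N T S) (HahnPaths.pathProcess N T S)
        (S + N - 1) N (HahnPaths.hahnSupport N T S) (HahnPaths.hahnF N T S)
        (HahnPaths.hahnC N T) ∧
      HahnPaths.IsDeterminantalWithKernel (HahnPaths.pathMeasure N T S)
        (HahnPaths.pathProcess N T S)
        (HahnPaths.extendedKernel (S + N - 1) N (HahnPaths.hahnF N T S) (HahnPaths.hahnC N T)) := by
  have := HahnPaths.isProbabilityMeasure_pathMeasure (N := N) hST
  have hY := HahnPaths.hasChainLaw_pathMeasure hN hST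
  have hB := HahnPaths.linkedBases_hahnF hN hST
  exact ⟨hY.meetsEynardMehta hB fun t ω => (HahnPaths.PathFamily.points_config t ω).symm,
    hY.isDeterminantalWithKernel hB fun t ω => (HahnPaths.PathFamily.points_config t ω).symm⟩
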